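/- Let $(\Omega,\mathcal F,\mathbb P)$ be a probability space, $T>0$, $\alpha>0$, $\beta>1$. Let $W=(W_t)_{t\in\mathbb R}$ be a two-sided Brownian motion and $B=(B_t)_{t\ge0}$ a Brownian motion independent of $W$. Let $(\mathcal F_t)_{t\in[0,T]}$ be the completed natural filtration of $(W,B)$: $\mathcal F_t$ is generated by $W_s$ ($s\le t$), $B_s$ ($0\le s\le t$) and the null sets. Let $\mathcal D_\beta$ be the space of progressively measurable processes $\lambda$ on $[0,T]$ (identified when equal $dt\otimes\mathbb P$-a.e.) with $$\|\lambda\|_\beta:=\mathbb E\Big[\Big(\int_0^T\lambda_t^2\,dt\Big)^{\beta}\Big]^{\frac1{2\beta}}<\infty .$$ For $H\in(0,1)$, $t\ge0$, $s\in\mathbb R$ put $$K^H(t,s)=C(H)\big((t-s)_+^{H-1/2}-(-s)_+^{H-1/2}\big),\qquad C(H)=\Big(\int_0^\infty\big((1+s)^{H-1/2}-s^{H-1/2}\big)^2ds+\frac1{2H}\Big)^{-1/2},$$ where $x_+^a=x^a$ for $x>0$ and $x_+^a=0$ for $x\le0$. Let $B^H$ be the fractional Brownian motion driven by $W$, that is,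 the continuous process with $B^H_t=\int_{\mathbb R}K^H(t,s)\,dW_s$ a.s. for each $t\ge0$. Let $\sigma_0$ be an $\mathcal F_0$-measurable random variable that does not depend on $H$ and satisfies $\mathbb E[e^{-c\sigma_0}]<\infty$ for all $c>0$ (for instance a constant or a Gaussian variable). Let $\sigma^H$ be the fractional Ornstein–Uhlenbeck process on $[0,T]$, that is, the continuous pathwise solution of $$d\sigma^H_t=-\alpha\sigma^H_t\,dt+dB^H_t,\qquad \sigma^H_0=\sigma_0 .$$ Then for every $H\in(0,1)$ the process $\big(\int_{\mathbb R}\partial_HK^H(t,s)\,dW_s\big)_{t\in[0,T]}$ has a progressively measurable version. For any such version $A^H$, put $$D\lambda^H_t:=A^H_t-\alpha e^{-\alpha t}\int_0^tA^H_u\,e^{\alpha u}\,du ,\qquad t\in[0,T].$$ Then $e^{-\sigma^H}$ and $-e^{-\sigma^H}D\lambda^H$ belong to $\mathcal D_\beta$, and the mapping $(0,1)\to\mathcal D_\beta$, $h\mapsto e^{-\sigma^h}=(e^{-\sigma^h_t})_{t\in[0,T]}$, is Fréchet differentiable at $H$ with derivative $-e^{-\sigma^H}D\lambda^H$, i.e.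 the linear map $\varepsilon\mapsto-\varepsilon\,e^{-\sigma^H}D\lambda^H$. -/

import Mathlib

open MeasureTheory ProbabilityTheory Filter Set
open scoped ENNReal NNReal Topology

noncomputable section

namespace HurstSensitivity

/-! ### Processes on `[0,T]` and the Banach space `D_β` -/

section Space

variable {Ω : Type*} [mΩ : MeasurableSpace Ω] {T : ℝ}

/-- Lebesgue measure `dt` on `[0,T]`. -/
def timeMeasure (T : ℝ) : Measure (Icc (0 : ℝ) T) := Measure.comap Subtype.val volume

instance : IsFiniteMeasure (timeMeasure T) := ⟨by
  rw [timeMeasure, (MeasurableEmbedding.subtype_coe measurableSet_Icc).comap_apply]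
  exact (measure_mono (Subtype.coe_image_subset _ _)).trans_lt measure_Icc_lt_top⟩

/-- The extended-valued norm `‖X‖_β = E[(∫₀ᵀ X_t² dt)^β]^{1/(2β)}` of a process on `[0,T]`. -/
def processENorm (μ : Measure Ω) (β : ℝ) (X : Icc (0 : ℝ) T → Ω → ℝ) : ℝ≥0∞ :=
  (∫⁻ ω, (∫⁻ t : Icc (0 : ℝ) T, ‖X t ω‖ₑ ^ (2 : ℝ) ∂timeMeasure T) ^ β ∂μ) ^ (1 / (2 * β))

/-- A progressively measurable process on `[0,T]` is jointly measurable. -/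
theorem measurable_uncurry_of_progressive {F : Filtration (Icc (0 : ℝ) T) mΩ}
    {X : Icc (0 : ℝ) T → Ω → ℝ} (hX : IsStronglyProgressive F X) :
    Measurable fun p : Ω × Icc (0 : ℝ) T => X p.2 p.1 := by
  rcases le_or_gt 0 T with hT | hT
  · let i : Icc (0 : ℝ) T := ⟨T, hT, le_rfl⟩
    have h1 := (hX i).measurable
    have h2 : @Measurable _ _ _ (@Prod.instMeasurableSpace _ _ _ (F i))
        fun p : Ω × Icc (0 : ℝ) T => ((⟨p.2, p.2.2.2⟩ : Set.Iic i), p.1) := by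
      have h3 : Measurable fun p : Ω × Icc (0 : ℝ) T => ((⟨p.2, p.2.2.2⟩ : Set.Iic i), p.1) :=
        (Measurable.subtype_mk measurable_snd).prodMk measurable_fst
      refine h3.mono le_rfl ?_
      exact sup_le_sup le_rfl (MeasurableSpace.comap_mono (F.le i))
    exact h1.comp h2
  · have : IsEmpty (Ω × Icc (0 : ℝ) T) := ⟨fun p => by
      have := p.2.2.1.trans p.2.2.2
      linarith⟩
    exact measurable_of_empty _

theorem processENorm_eq (μ : Measure Ω) {β : ℝ} (X : Icc (0 : ℝ) T → Ω → ℝ) :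
    processENorm μ β X =
      (∫⁻ ω, ((∫⁻ t : Icc (0 : ℝ) T, ‖X t ω‖ₑ ^ (2 : ℝ) ∂timeMeasure T) ^ (1 / (2 : ℝ))) ^ (2 * β) ∂μ)
        ^ (1 / (2 * β)) := by
  unfold processENorm
  congr 1
  refine lintegral_congr fun ω => ?_
  rw [← ENNReal.rpow_mul]
  congr 1
  ring

theorem processENorm_add_le (μ : Measure Ω) {β : ℝ} (hβ : 1 < β)
    {F : Filtration (Icc (0 : ℝ) T) mΩ} {X Y : Icc (0 : ℝ) T → Ω → ℝ}
    (hX : IsStronglyProgressive F X) (hY : IsStronglyProgressive F Y) :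
    processENorm μ β (X + Y) ≤ processENorm μ β X + processENorm μ β Y := by
  have mX := measurable_uncurry_of_progressive hX
  have mY := measurable_uncurry_of_progressive hY
  have key : ∀ Z : Icc (0 : ℝ) T → Ω → ℝ,
      (Measurable fun p : Ω × Icc (0 : ℝ) T => Z p.2 p.1) →
      Measurable fun ω => (∫⁻ t : Icc (0 : ℝ) T, ‖Z t ω‖ₑ ^ (2 : ℝ) ∂timeMeasure T) ^ (1 / (2 : ℝ)) := by
    intro Z hZ
    exact ((hZ.enorm.pow_const (2 : ℝ)).lintegral_prod_right').pow_const _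
  rw [processENorm_eq, processENorm_eq, processENorm_eq]
  refine le_trans ?_ (ENNReal.lintegral_Lp_add_le (key X mX).aemeasurable (key Y mY).aemeasurable
    (by linarith))
  refine ENNReal.rpow_le_rpow (lintegral_mono fun ω => ?_) (by positivity)
  refine ENNReal.rpow_le_rpow ?_ (by positivity)
  refine le_trans ?_ (ENNReal.lintegral_Lp_add_le
    (mX.comp (measurable_prodMk_left (x := ω))).enorm.aemeasurable
    (mY.comp (measurable_prodMk_left (x := ω))).enorm.aemeasurable (by norm_num))
  refine ENNReal.rpow_le_rpow (lintegral_mono fun t => ?_) (by positivity)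
  exact ENNReal.rpow_le_rpow (enorm_add_le _ _) (by positivity)

theorem processENorm_smul (μ : Measure Ω) {β : ℝ} (hβ : 1 < β) (c : ℝ)
    (X : Icc (0 : ℝ) T → Ω → ℝ) :
    processENorm μ β (c • X) = ‖c‖ₑ * processENorm μ β X := by
  have h0 : (0 : ℝ) < β := by linarith
  unfold processENorm
  simp only [Pi.smul_apply, smul_eq_mul, enorm_mul]
  simp_rw [ENNReal.mul_rpow_of_nonneg _ _ (zero_le_two : (0 : ℝ) ≤ 2)]
  have h1 : ∀ ω, (∫⁻ t : Icc (0 : ℝ) T, ‖c‖ₑ ^ (2 : ℝ) * ‖X t ω‖ₑ ^ (2 : ℝ) ∂timeMeasure T) ^ β =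
      ‖c‖ₑ ^ (2 * β) * (∫⁻ t : Icc (0 : ℝ) T, ‖X t ω‖ₑ ^ (2 : ℝ) ∂timeMeasure T) ^ β := by
    intro ω
    rw [lintegral_const_mul' _ _ (by finiteness), ENNReal.mul_rpow_of_nonneg _ _ h0.le,
      ← ENNReal.rpow_mul]
  simp_rw [h1]
  rw [lintegral_const_mul' _ _ (ENNReal.rpow_ne_top_of_nonneg (by positivity) enorm_ne_top),
    ENNReal.mul_rpow_of_nonneg _ _ (by positivity), ← ENNReal.rpow_mul,
    mul_one_div_cancel (by positivity), ENNReal.rpow_one]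

/-- The progressively measurable processes `X` on `[0,T]` with `‖X‖_β < ∞`. -/
def processSubmodule (F : Filtration (Icc (0 : ℝ) T) mΩ) (μ : Measure Ω) (β : ℝ) (hβ : 1 < β) :
    Submodule ℝ (Icc (0 : ℝ) T → Ω → ℝ) where
  carrier := {X | IsStronglyProgressive F X ∧ processENorm μ β X < ∞}
  add_mem' := fun hX hY => ⟨hX.1.add hY.1,
    (processENorm_add_le μ hβ hX.1 hY.1).trans_lt (ENNReal.add_lt_top.2 ⟨hX.2, hY.2⟩)⟩
  zero_mem' := by
    have h0 : (0 : ℝ) < β := by linarith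
    refine ⟨fun i => stronglyMeasurable_zero, ?_⟩
    simpa using (processENorm_smul (T := T) μ hβ 0 0).trans_lt (by simp)
  smul_mem' := fun c X hX => ⟨fun i => (hX.1 i).const_smul c, by
    rw [processENorm_smul μ hβ]
    exact ENNReal.mul_lt_top enorm_lt_top hX.2⟩

/-- The same processes, as a type of its own carrying the seminorm `‖·‖_β`. -/
def ProcessSpace (F : Filtration (Icc (0 : ℝ) T) mΩ) (μ : Measure Ω) (β : ℝ) (hβ : 1 < β) : Type _ :=
  processSubmodule F μ β hβ

variable {F : Filtration (Icc (0 : ℝ) T) mΩ} {μ : Measure Ω} {β : ℝ} {hβ : 1 < β}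

instance : AddCommGroup (ProcessSpace F μ β hβ) :=
  inferInstanceAs (AddCommGroup (processSubmodule F μ β hβ))

instance : Module ℝ (ProcessSpace F μ β hβ) :=
  inferInstanceAs (Module ℝ (processSubmodule F μ β hβ))

instance : Norm (ProcessSpace F μ β hβ) :=
  ⟨fun X => (processENorm μ β X.1).toReal⟩

theorem processSpace_core : SeminormedSpace.Core ℝ (ProcessSpace F μ β hβ) where
  norm_nonneg _ := ENNReal.toReal_nonneg
  norm_smul c X := by
    change (processENorm μ β (c • X.1)).toReal = ‖c‖ * (processENorm μ β X.1).toReal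
    rw [processENorm_smul μ hβ, ENNReal.toReal_mul, toReal_enorm]
  norm_triangle X Y := by
    change (processENorm μ β (X.1 + Y.1)).toReal ≤
      (processENorm μ β X.1).toReal + (processENorm μ β Y.1).toReal
    rw [← ENNReal.toReal_add X.2.2.ne Y.2.2.ne]
    exact ENNReal.toReal_mono (ENNReal.add_ne_top.2 ⟨X.2.2.ne, Y.2.2.ne⟩)
      (processENorm_add_le μ hβ X.2.1 Y.2.1)

instance : SeminormedAddCommGroup (ProcessSpace F μ β hβ) :=
  SeminormedAddCommGroup.ofCore processSpace_core

instance : NormedSpace ℝ (ProcessSpace F μ β hβ) :=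
  ⟨fun c X => (processSpace_core.norm_smul c X).le⟩

/-- The space `D_β` of progressively measurable processes of finite norm `‖·‖_β`, where processes
at distance `0` (that is, equal `dt ⊗ P`-almost everywhere) are identified. -/
abbrev DSpace (F : Filtration (Icc (0 : ℝ) T) mΩ) (μ : Measure Ω) (β : ℝ) (hβ : 1 < β) : Type _ :=
  SeparationQuotient (ProcessSpace F μ β hβ)

/-- A process in `processSubmodule F μ β hβ`, as an element of `ProcessSpace F μ β hβ`. -/
def ProcessSpace.of (X : Icc (0 : ℝ) T → Ω → ℝ) (h : X ∈ processSubmodule F μ β hβ) :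
    ProcessSpace F μ β hβ :=
  ⟨X, h⟩

/-- The process `X`, restricted to `[0,T]`, belongs to `D_β`. -/
def MemD (F : Filtration (Icc (0 : ℝ) T) mΩ) (μ : Measure Ω) (β : ℝ) (hβ : 1 < β)
    (X : ℝ → Ω → ℝ) : Prop :=
  (fun t : Icc (0 : ℝ) T => X t) ∈ processSubmodule F μ β hβ

open Classical in
/-- The element of `D_β` given by the restriction to `[0,T]` of a process `X`; only meaningful if
`MemD F μ β hβ X` (value `0` otherwise). -/
def toD (F : Filtration (Icc (0 : ℝ) T) mΩ) (μ : Measure Ω) (β : ℝ) (hβ : 1 < β)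
    (X : ℝ → Ω → ℝ) : DSpace F μ β hβ :=
  if h : MemD F μ β hβ X then SeparationQuotient.mk (ProcessSpace.of _ h) else 0

end Space

/-! ### Brownian motions, filtration and Wiener integrals -/

section Driving

variable {Ω : Type*} [mΩ : MeasurableSpace Ω]

/-- `(W_t)_{t ∈ ℝ}` is a two-sided Brownian motion. -/
structure IsTwoSidedBrownian (μ : Measure Ω) (W : ℝ → Ω → ℝ) : Prop where
  forward : IsBrownianReal (fun t : ℝ≥0 => W t) μ
  backward : IsBrownianReal (fun t : ℝ≥0 => W (-t)) μ
  indep : IndepFun (fun ω (t : ℝ≥0) => W t ω) (fun ω (t : ℝ≥0) => W (-t) ω) μ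

/-- `W` is a two-sided Brownian motion and `B` is a Brownian motion independent of `W`. -/
structure IsDrivingPair (μ : Measure Ω) (W : ℝ → Ω → ℝ) (B : ℝ≥0 → Ω → ℝ) : Prop where
  measurable_W : ∀ t, Measurable (W t)
  measurable_B : ∀ t, Measurable (B t)
  brownian_W : IsTwoSidedBrownian μ W
  brownian_B : IsBrownianReal B μ
  indep : IndepFun (fun ω (t : ℝ) => W t ω) (fun ω (t : ℝ≥0) => B t ω) μ

/-- The completed natural filtration of `(W, B)` on `[0,T]`: at time `t` it is generated by
`W_s` (`s ≤ t`, including negative times), `B_s` (`0 ≤ s ≤ t`) and the null sets. -/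
def naturalFiltration (T : ℝ) {μ : Measure Ω} {W : ℝ → Ω → ℝ} {B : ℝ≥0 → Ω → ℝ}
    (h : IsDrivingPair μ W B) : Filtration (Icc (0 : ℝ) T) mΩ where
  seq t := (⨆ s : ℝ, ⨆ _ : s ≤ t, MeasurableSpace.comap (W s) inferInstance) ⊔
    (⨆ s : ℝ≥0, ⨆ _ : (s : ℝ) ≤ t, MeasurableSpace.comap (B s) inferInstance) ⊔
    MeasurableSpace.generateFrom {N | MeasurableSet N ∧ μ N = 0}
  mono' t t' htt' := by
    have h' : (t : ℝ) ≤ t' := htt'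
    refine sup_le_sup (sup_le_sup ?_ ?_) le_rfl
    · exact iSup₂_le fun s hs => le_iSup₂_of_le s (hs.trans h') le_rfl
    · exact iSup₂_le fun s hs => le_iSup₂_of_le s (hs.trans h') le_rfl
  le' t := by
    refine sup_le (sup_le ?_ ?_) ?_
    · exact iSup₂_le fun s _ => (h.measurable_W s).comap_le
    · exact iSup₂_le fun s _ => (h.measurable_B s).comap_le
    · exact MeasurableSpace.generateFrom_le fun N hN => hN.1

/-- Step functions `∑ᵢ cᵢ 1_{(aᵢ, bᵢ]}` on the real line. -/
structure StepFunction where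
  n : ℕ
  c : Fin n → ℝ
  a : Fin n → ℝ
  b : Fin n → ℝ
  a_le_b : ∀ i, a i ≤ b i

/-- The values of a step function. -/
def StepFunction.eval (φ : StepFunction) (s : ℝ) : ℝ :=
  ∑ i, φ.c i * (Ioc (φ.a i) (φ.b i)).indicator (fun _ => (1 : ℝ)) s

/-- The Wiener integral `∑ᵢ cᵢ (W_{bᵢ} - W_{aᵢ})` of a step function. -/
def StepFunction.wiener (φ : StepFunction) (W : ℝ → Ω → ℝ) (ω : Ω) : ℝ :=
  ∑ i, φ.c i * (W (φ.b i) ω - W (φ.a i) ω)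

/-- `Y` is (a version of) the Wiener integral `∫_ℝ f(s) dW_s` of `f ∈ L²(ℝ)`: the limit in `L²(P)` of
the integrals of step functions that converge to `f` in `L²(ℝ)`. -/
def IsWienerIntegral (μ : Measure Ω) (W : ℝ → Ω → ℝ) (f : ℝ → ℝ) (Y : Ω → ℝ) : Prop :=
  MemLp f 2 volume ∧ MemLp Y 2 μ ∧ ∃ φ : ℕ → StepFunction,
    Tendsto (fun n => eLpNorm (fun s => (φ n).eval s - f s) 2 volume) atTop (𝓝 0) ∧
    Tendsto (fun n => eLpNorm (fun ω => (φ n).wiener W ω - Y ω) 2 μ) atTop (𝓝 0)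

/-! ### Fractional Brownian motion and the fractional Ornstein-Uhlenbeck process -/

/-- The normalizing constant `C(H)`. -/
def normConst (H : ℝ) : ℝ :=
  ((∫ s in Ioi (0 : ℝ), ((1 + s) ^ (H - 1 / 2) - s ^ (H - 1 / 2)) ^ 2) + 1 / (2 * H)) ^
    (-(1 / 2) : ℝ)

/-- `x_+^a`, equal to `x^a` for `x > 0` and to `0` for `x ≤ 0` (also when `a = 0`). -/
def posPow (x a : ℝ) : ℝ := if 0 < x then x ^ a else 0

/-- The kernel `K^H(t,s) = C(H) ((t-s)_+^{H-1/2} - (-s)_+^{H-1/2})`. -/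
def kernel (H t s : ℝ) : ℝ :=
  normConst H * (posPow (t - s) (H - 1 / 2) - posPow (-s) (H - 1 / 2))

/-- The partial derivative `∂_H K^H(t,s)`. -/
def kernelDeriv (H t s : ℝ) : ℝ := deriv (fun h => kernel h t s) H

/-- `X` is the fractional Brownian motion with Hurst parameter `H` driven by `W`: the continuous
process with `X_t = ∫_ℝ K^H(t,s) dW_s` almost surely, for every `t ≥ 0`. -/
structure IsFractionalBrownian (μ : Measure Ω) (W : ℝ → Ω → ℝ) (H : ℝ) (X : ℝ → Ω → ℝ) :
    Prop where
  measurable : ∀ t, 0 ≤ t → Measurable (X t)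
  continuous : ∀ ω, ContinuousOn (fun t => X t ω) (Ici 0)
  repr : ∀ t, 0 ≤ t → IsWienerIntegral μ W (kernel H t) (X t)

/-- `Y` is the pathwise solution on `[0,T]` of `dY_t = -α Y_t dt + dX_t`, `Y_0 = y₀`. -/
structure IsOrnsteinUhlenbeck (T α : ℝ) (y₀ : Ω → ℝ) (X Y : ℝ → Ω → ℝ) : Prop where
  continuous : ∀ ω, ContinuousOn (fun t => Y t ω) (Icc 0 T)
  eq : ∀ ω, ∀ t ∈ Icc 0 T,
    Y t ω = y₀ ω + (∫ u in (0 : ℝ)..t, -α * Y u ω) + (X t ω - X 0 ω)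

/-- `A` is a progressively measurable version on `[0,T]` of the process
`∫_ℝ ∂_H K^H(t,s) dW_s`. -/
structure IsKernelDerivProcess {T : ℝ} (F : Filtration (Icc (0 : ℝ) T) mΩ) (μ : Measure Ω)
    (W : ℝ → Ω → ℝ) (H : ℝ) (A : ℝ → Ω → ℝ) : Prop where
  progressive : IsStronglyProgressive F (fun t : Icc (0 : ℝ) T => A t)
  repr : ∀ t ∈ Icc 0 T, IsWienerIntegral μ W (kernelDeriv H t) (A t)

/-- The process `Dλ_t = A_t - α e^{-αt} ∫₀ᵗ A_u e^{αu} du`. -/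
def dLambda (α : ℝ) (A : ℝ → Ω → ℝ) (t : ℝ) (ω : Ω) : ℝ :=
  A t ω - α * Real.exp (-α * t) * ∫ u in (0 : ℝ)..t, A u ω * Real.exp (α * u)

end Driving

end HurstSensitivity

end

/-! The mechanism is that everything except the exponential is linear in the driving noise. An
integrating factor gives `σ^h_t = e^{-αt} σ₀ + (dLambda of B^h - B^h_0)_t`
(`IsOrnsteinUhlenbeck.eq_dLambda`), and `dLambda` is a linear operator on paths. Hence `σ^h - σ^H`
and `σ^h - σ^H - (h - H) Dλ^H` are `dLambda` applied to processes that are, at each fixed time,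
Wiener integrals of `K^h - K^H` and of `K^h - K^H - (h - H) ∂_H K^H`.

The analytic core is `exists_kernel_bounds`: in `L²(ℝ)`, uniformly in `t ∈ [0,T]`, these kernels are
`O(|h - H|)` and `o(|h - H|)`. It rests on one square integrable majorant for the `a`-derivatives up
to order two of `(t-s)_+^a - (-s)_+^a` (`exists_rawKernel_majorant`) and on the differentiability of
the normalizing constant.

Kernel norms become moments through the Gaussian law. The isometry and the moment generating
function are computed for step functions and passed to the limit by Fatou, so that every moment of a
Wiener integral is bounded by the matching power of the norm of its kernel
(`IsWienerIntegral.lintegral_rpow_le`). Jensen's inequality in time gives exponential moments of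
`-σ^h`, uniformly for `h` near `H` (`lintegral_exp_neg_le`).

Finally `|e^x - 1 - x| ≤ x² (1 + e^x)` and the Cauchy-Schwarz inequality separate the exponential
weights from the increments (`lintegral_exp_remainder_le`). The moment of order `2β` of the
remainder at time `t` is then at most a constant times `(2 |h - H|² + r h)^{2β}` with `r h = o(h -
H)`, uniformly in `t`, which controls the norm of `D_β` (`processENorm_le`).

The version `A^H` is the pointwise limit of difference quotients of `h ↦ B^h` along a single
sequence converging so fast that the quotients converge almost surely at each time. -/

noncomputable section

namespace HurstSensitivity

/-! ### Step functions -/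

namespace StepFunction

variable {Ω : Type*} {W : ℝ → Ω → ℝ}

/-- The sum of two step functions. -/
def add (φ ψ : StepFunction) : StepFunction where
  n := φ.n + ψ.n
  c := Fin.append φ.c ψ.c
  a := Fin.append φ.a ψ.a
  b := Fin.append φ.b ψ.b
  a_le_b i := by
    refine Fin.addCases (fun j => ?_) (fun j => ?_) i
    · simpa using φ.a_le_b j
    · simpa using ψ.a_le_b j

/-- A scalar multiple of a step function. -/
def smul (r : ℝ) (φ : StepFunction) : StepFunction where
  n := φ.n
  c i := r * φ.c i
  a := φ.a
  b := φ.b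
  a_le_b := φ.a_le_b

/-- The step function cut off after time `t`. -/
def cutoff (φ : StepFunction) (t : ℝ) : StepFunction where
  n := φ.n
  c := φ.c
  a i := min (φ.a i) t
  b i := min (φ.b i) t
  a_le_b i := min_le_min_right _ (φ.a_le_b i)

theorem eval_add (φ ψ : StepFunction) (s : ℝ) : (φ.add ψ).eval s = φ.eval s + ψ.eval s :=
  (Fin.sum_univ_add _).trans (by simp [eval, add])

theorem wiener_add (φ ψ : StepFunction) (ω : Ω) :
    (φ.add ψ).wiener W ω = φ.wiener W ω + ψ.wiener W ω :=
  (Fin.sum_univ_add _).trans (by simp [wiener, add])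

theorem eval_smul (r : ℝ) (φ : StepFunction) (s : ℝ) : (φ.smul r).eval s = r * φ.eval s := by
  simp only [eval, smul, Finset.mul_sum, mul_assoc]
  rfl

theorem wiener_smul (r : ℝ) (φ : StepFunction) (ω : Ω) :
    (φ.smul r).wiener W ω = r * φ.wiener W ω := by
  simp only [wiener, smul, Finset.mul_sum, mul_assoc]
  rfl

/-- `(min a t, min b t]` equals `(a, b] ∩ (-∞, t]`, and is empty when both endpoints lie beyond `t`.
The cut-off integral uses only `W_s` with `s ≤ t`, which is what adaptedness requires. -/
theorem eval_cutoff (φ : StepFunction) (t s : ℝ) :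
    (φ.cutoff t).eval s = (Iic t).indicator φ.eval s := by
  by_cases h : s ≤ t
  · rw [indicator_of_mem (show s ∈ Iic t from h)]
    refine Finset.sum_congr rfl fun i _ => ?_
    have : φ.a i < s ∨ t < s ↔ φ.a i < s := ⟨fun h' => h'.resolve_right h.not_gt, Or.inl⟩
    simp [cutoff, indicator_apply, h, this]
  · rw [indicator_of_notMem (show s ∉ Iic t from h)]
    refine Finset.sum_eq_zero fun i _ => ?_
    simp [cutoff, h]

theorem memLp_eval (φ : StepFunction) (p : ℝ≥0∞) : MemLp φ.eval p volume := by
  unfold eval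
  refine memLp_finsetSum _ fun i _ => MemLp.const_mul ?_ _
  exact memLp_indicator_const p measurableSet_Ioc 1 (Or.inr measure_Ioc_lt_top.ne)

/-- A product of two interval indicators is the indicator of the intersection; the maximum with `0`
is its length, also when it is empty. -/
theorem integral_eval_sq (φ : StepFunction) :
    ∫ s, φ.eval s ^ 2 = ∑ i, ∑ j, φ.c i * φ.c j *
      max 0 (min (φ.b i) (φ.b j) - max (φ.a i) (φ.a j)) := by
  have h1 : ∀ s, φ.eval s ^ 2 = ∑ i, ∑ j, φ.c i * φ.c j *
      (Ioc (max (φ.a i) (φ.a j)) (min (φ.b i) (φ.b j))).indicator (fun _ => (1 : ℝ)) s := by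
    intro s
    rw [eval, sq, Finset.sum_mul_sum]
    refine Finset.sum_congr rfl fun i _ => Finset.sum_congr rfl fun j _ => ?_
    rw [← Ioc_inter_Ioc, ← Set.indicator_indicator]
    by_cases h1 : s ∈ Ioc (φ.a i) (φ.b i) <;> simp [h1, mul_assoc]
  have h2 : ∀ i j, Integrable (fun s => φ.c i * φ.c j *
      (Ioc (max (φ.a i) (φ.a j)) (min (φ.b i) (φ.b j))).indicator (fun _ => (1 : ℝ)) s) := by
    intro i j
    refine Integrable.const_mul ?_ _
    exact (integrable_indicator_iff measurableSet_Ioc).2 (by simp)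
  simp_rw [h1]
  rw [integral_finsetSum _ fun i _ => integrable_finsetSum _ fun j _ => h2 i j]
  refine Finset.sum_congr rfl fun i _ => ?_
  rw [integral_finsetSum _ fun j _ => h2 i j]
  refine Finset.sum_congr rfl fun j _ => ?_
  rw [integral_const_mul, integral_indicator measurableSet_Ioc, setIntegral_const, measureReal_def,
    Real.volume_Ioc, ENNReal.toReal_ofReal', smul_eq_mul, mul_one, max_comm 0]

end StepFunction

/-! ### Two-sided Brownian motion -/

section Wiener

variable {Ω : Type*} [mΩ : MeasurableSpace Ω] {μ : Measure Ω} {W : ℝ → Ω → ℝ}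

/-- The covariance of a two-sided Brownian motion. -/
def brownianCov (s t : ℝ) : ℝ := (|s| + |t| - |s - t|) / 2

/-- The two minima are the covariances of the forward and of the backward half of `W`. For times of
opposite sign both are `0`. -/
theorem brownianCov_eq (s t : ℝ) : brownianCov s t =
    ((min s.toNNReal t.toNNReal : ℝ≥0) : ℝ) + ((min (-s).toNNReal (-t).toNNReal : ℝ≥0) : ℝ) := by
  simp only [NNReal.coe_min, Real.coe_toNNReal', brownianCov]
  rcases abs_cases s with ⟨h1, h1'⟩ | ⟨h1, h1'⟩ <;> rcases abs_cases t with ⟨h2, h2'⟩ | ⟨h2, h2'⟩ <;>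
    rcases abs_cases (s - t) with ⟨h3, h3'⟩ | ⟨h3, h3'⟩ <;> rw [h1, h2, h3] <;> grind

/-- The right side is the length of `(a, b] ∩ (c, d]`, the quantity of `integral_eval_sq`; this
coincidence is the Itô isometry. -/
theorem brownianCov_increments {a b c d : ℝ} (h : a ≤ b) (h' : c ≤ d) :
    brownianCov b d - brownianCov b c - (brownianCov a d - brownianCov a c) =
      max 0 (min b d - max a c) := by
  unfold brownianCov
  grind [abs_cases]

/-- Finite linear combinations of values of a pre-Brownian motion are Gaussian. -/
theorem hasGaussianLaw_sum_of_isPreBrownianReal {X : ℝ≥0 → Ω → ℝ} (hX : IsPreBrownianReal X μ)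
    {ι : Type*} [Fintype ι] (c : ι → ℝ) (t : ι → ℝ≥0) :
    HasGaussianLaw (fun ω => ∑ i, c i * X (t i) ω) μ := by
  classical
  let I : Finset ℝ≥0 := Finset.univ.image t
  have hI : ∀ i, t i ∈ I := fun i => Finset.mem_image_of_mem t (Finset.mem_univ i)
  let L : (I → ℝ) →L[ℝ] ℝ :=
    ∑ i, c i • ContinuousLinearMap.proj (R := ℝ) (φ := fun _ : I => ℝ) ⟨t i, hI i⟩
  refine ((hX.hasLaw I).hasGaussianLaw.map_fun L).congr (ae_of_all _ fun ω => ?_)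
  simp [L, Finset.restrict]

namespace IsTwoSidedBrownian

/-- One of the two terms on the right is `W 0`, which vanishes only almost surely. The splitting
reduces the two-sided motion to two independent one-sided ones. -/
theorem ae_eq (h : IsTwoSidedBrownian μ W) (t : ℝ) :
    W t =ᵐ[μ] fun ω => W (t.toNNReal : ℝ) ω + W (-((-t).toNNReal : ℝ)) ω := by
  have h0 := h.forward.toIsPreBrownianReal.eval_zero_ae_eq_zero
  filter_upwards [h0] with ω h0
  simp only [NNReal.coe_zero] at h0
  rcases le_total 0 t with ht | ht
  · simp [Real.toNNReal_of_nonpos (neg_nonpos.2 ht), Real.coe_toNNReal _ ht, h0]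
  · simp [Real.toNNReal_of_nonpos ht, Real.coe_toNNReal _ (neg_nonneg.2 ht), h0]

theorem hasGaussianLaw_sum (h : IsTwoSidedBrownian μ W) {ι : Type*} [Fintype ι] (c t : ι → ℝ) :
    HasGaussianLaw (fun ω => ∑ i, c i * W (t i) ω) μ := by
  have hF : HasGaussianLaw (fun ω => ∑ i, c i * W ((t i).toNNReal : ℝ) ω) μ :=
    hasGaussianLaw_sum_of_isPreBrownianReal h.forward.toIsPreBrownianReal c
      fun i => (t i).toNNReal
  have hG : HasGaussianLaw (fun ω => ∑ i, c i * W (-((-(t i)).toNNReal : ℝ)) ω) μ :=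
    hasGaussianLaw_sum_of_isPreBrownianReal h.backward.toIsPreBrownianReal c
      fun i => (-(t i)).toNNReal
  have hi : IndepFun (fun ω => ∑ i, c i * W ((t i).toNNReal : ℝ) ω)
      (fun ω => ∑ i, c i * W (-((-(t i)).toNNReal : ℝ)) ω) μ := by
    have m1 : Measurable fun x : ℝ≥0 → ℝ => ∑ i, c i * x (t i).toNNReal :=
      Finset.measurable_sum _ fun i _ => (measurable_pi_apply _).const_mul _
    have m2 : Measurable fun x : ℝ≥0 → ℝ => ∑ i, c i * x (-(t i)).toNNReal :=
      Finset.measurable_sum _ fun i _ => (measurable_pi_apply _).const_mul _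
    exact h.indep.comp m1 m2
  refine (hi.hasGaussianLaw hF hG).fun_add.congr ?_
  have h1 : ∀ᵐ ω ∂μ, ∀ i, W (t i) ω =
      W ((t i).toNNReal : ℝ) ω + W (-((-(t i)).toNNReal : ℝ)) ω :=
    ae_all_iff.2 fun i => h.ae_eq (t i)
  filter_upwards [h1] with ω h1
  rw [← Finset.sum_add_distrib]
  refine Finset.sum_congr rfl fun i _ => ?_
  rw [h1 i]
  ring

theorem memLp (h : IsTwoSidedBrownian μ W) (t : ℝ) : MemLp (W t) 2 μ := by
  have := h.hasGaussianLaw_sum (fun _ : Unit => 1) (fun _ => t)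
  simpa using this.memLp_two

theorem integral_eq_zero (h : IsTwoSidedBrownian μ W) (t : ℝ) : ∫ ω, W t ω ∂μ = 0 := by
  rw [integral_congr_ae (h.ae_eq t), integral_add]
  · rw [h.forward.toIsPreBrownianReal.integral_eval, h.backward.toIsPreBrownianReal.integral_eval,
      add_zero]
  · exact h.forward.toIsPreBrownianReal.integrable_eval _
  · exact h.backward.toIsPreBrownianReal.integrable_eval _

theorem covariance_eq [IsProbabilityMeasure μ] (h : IsTwoSidedBrownian μ W) (s t : ℝ) :
    cov[W s, W t; μ] = brownianCov s t := by
  have hF := fun u : ℝ≥0 => h.memLp (u : ℝ)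
  have hG := fun u : ℝ≥0 => h.memLp (-(u : ℝ))
  have hi : ∀ u v : ℝ≥0, cov[W (u : ℝ), W (-(v : ℝ)); μ] = 0 := fun u v =>
    (h.indep.comp (measurable_pi_apply u) (measurable_pi_apply v)).covariance_eq_zero (hF u) (hG v)
  have e1 : cov[W s, W t; μ] = cov[W (s.toNNReal : ℝ) + W (-((-s).toNNReal : ℝ)),
      W (t.toNNReal : ℝ) + W (-((-t).toNNReal : ℝ)); μ] := by
    have h1 : μ[W s] = μ[W (s.toNNReal : ℝ) + W (-((-s).toNNReal : ℝ))] :=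
      integral_congr_ae (h.ae_eq s)
    have h2 : μ[W t] = μ[W (t.toNNReal : ℝ) + W (-((-t).toNNReal : ℝ))] :=
      integral_congr_ae (h.ae_eq t)
    rw [covariance, covariance, h1, h2]
    refine integral_congr_ae ?_
    filter_upwards [h.ae_eq s, h.ae_eq t] with ω h3 h4
    rw [h3, h4]
    rfl
  rw [e1, covariance_add_left (hF _) (hG _) ((hF _).add (hG _)),
    covariance_add_right (hF _) (hF _) (hG _), covariance_add_right (hG _) (hF _) (hG _), hi,
    covariance_comm (W (-((-s).toNNReal : ℝ))) (W (t.toNNReal : ℝ)), hi, h.forward.toIsPreBrownianReal.covariance_eval,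
    h.backward.toIsPreBrownianReal.covariance_eval, brownianCov_eq]
  simp

end IsTwoSidedBrownian

end Wiener

section WienerIntegral

variable {Ω : Type*} [mΩ : MeasurableSpace Ω] {μ : Measure Ω} {W : ℝ → Ω → ℝ}

/-! ### Wiener integrals of step functions -/

namespace StepFunction

theorem hasGaussianLaw_wiener (φ : StepFunction) (h : IsTwoSidedBrownian μ W) :
    HasGaussianLaw (φ.wiener W) μ := by
  have := h.hasGaussianLaw_sum (Sum.elim φ.c fun i => -φ.c i) (Sum.elim φ.b φ.a)
  convert this using 2 with ω
  rw [Fintype.sum_sum_type, ← Finset.sum_add_distrib]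
  refine Finset.sum_congr rfl fun i _ => ?_
  simp only [Sum.elim_inl, Sum.elim_inr]
  ring

theorem integral_wiener (φ : StepFunction) (h : IsTwoSidedBrownian μ W) :
    ∫ ω, φ.wiener W ω ∂μ = 0 := by
  have : IsProbabilityMeasure μ := (φ.hasGaussianLaw_wiener h).isProbabilityMeasure
  have hi := fun t => (h.memLp t).integrable one_le_two
  unfold wiener
  have hd : ∀ i, Integrable (fun ω => φ.c i * (W (φ.b i) ω - W (φ.a i) ω)) μ :=
    fun i => ((hi _).sub (hi _)).const_mul _
  rw [integral_finsetSum _ fun i _ => hd i]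
  refine Finset.sum_eq_zero fun i _ => ?_
  rw [integral_const_mul, integral_sub (hi _) (hi _), h.integral_eq_zero, h.integral_eq_zero]
  simp

/-- The Itô isometry for step functions: bilinearity of the covariance reduces it to pairs of
increments, where `brownianCov_increments` matches `integral_eval_sq` term by term. -/
theorem variance_wiener (φ : StepFunction) (h : IsTwoSidedBrownian μ W) :
    Var[φ.wiener W; μ] = ∫ s, φ.eval s ^ 2 := by
  have : IsProbabilityMeasure μ := (φ.hasGaussianLaw_wiener h).isProbabilityMeasure
  have hi := h.memLp
  have hs : ∀ i, MemLp (W (φ.b i) - W (φ.a i)) 2 μ := fun i => (hi _).sub (hi _)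
  have hd : ∀ i, MemLp (fun ω => φ.c i * (W (φ.b i) ω - W (φ.a i) ω)) 2 μ :=
    fun i => (hs i).const_mul _
  rw [← covariance_self (φ.hasGaussianLaw_wiener h).aemeasurable, integral_eval_sq]
  unfold wiener
  rw [covariance_fun_sum_fun_sum hd hd]
  refine Finset.sum_congr rfl fun i _ => Finset.sum_congr rfl fun j _ => ?_
  rw [covariance_const_mul_left, covariance_const_mul_right, mul_assoc]
  have e : cov[W (φ.b i) - W (φ.a i), W (φ.b j) - W (φ.a j); μ] =
      max 0 (min (φ.b i) (φ.b j) - max (φ.a i) (φ.a j)) := by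
    rw [covariance_sub_left (hi _) (hi _) (hs j), covariance_sub_right (hi _) (hi _) (hi _),
      covariance_sub_right (hi _) (hi _) (hi _), h.covariance_eq, h.covariance_eq, h.covariance_eq,
      h.covariance_eq, brownianCov_increments (φ.a_le_b i) (φ.a_le_b j)]
  rw [← e]
  rfl

theorem memLp_wiener (φ : StepFunction) (h : IsTwoSidedBrownian μ W) : MemLp (φ.wiener W) 2 μ :=
  (φ.hasGaussianLaw_wiener h).memLp_two

theorem eLpNorm_wiener (φ : StepFunction) (h : IsTwoSidedBrownian μ W) :
    eLpNorm (φ.wiener W) 2 μ = eLpNorm φ.eval 2 volume := by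
  have : IsProbabilityMeasure μ := (φ.hasGaussianLaw_wiener h).isProbabilityMeasure
  rw [(φ.memLp_wiener h).eLpNorm_eq_integral_rpow_norm two_ne_zero ENNReal.ofNat_ne_top,
    (φ.memLp_eval 2).eLpNorm_eq_integral_rpow_norm two_ne_zero ENNReal.ofNat_ne_top]
  have := φ.variance_wiener h
  rw [variance_of_integral_eq_zero (φ.hasGaussianLaw_wiener h).aemeasurable (φ.integral_wiener h)]
    at this
  simp [this]

theorem lintegral_exp_wiener (φ : StepFunction) (h : IsTwoSidedBrownian μ W) (c : ℝ) :
    ∫⁻ ω, ENNReal.ofReal (Real.exp (c * φ.wiener W ω)) ∂μ =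
      ENNReal.ofReal (Real.exp (c ^ 2 * (eLpNorm φ.eval 2 volume).toReal ^ 2 / 2)) := by
  have hg := φ.hasGaussianLaw_wiener h
  have : IsProbabilityMeasure μ := hg.isProbabilityMeasure
  have hmap := hg.map_eq_gaussianReal
  rw [φ.integral_wiener h] at hmap
  have hm := mgf_gaussianReal hmap c
  have hv : (eLpNorm φ.eval 2 volume).toReal ^ 2 = Var[φ.wiener W; μ] := by
    rw [variance_wiener φ h,
      (φ.memLp_eval 2).eLpNorm_eq_integral_rpow_norm two_ne_zero ENNReal.ofNat_ne_top,
      ENNReal.toReal_ofReal (by positivity)]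
    simp only [ENNReal.toReal_ofNat, Real.rpow_ofNat, Real.norm_eq_abs, sq_abs]
    rw [← Real.rpow_natCast, ← Real.rpow_mul (integral_nonneg fun _ => sq_nonneg _)]
    norm_num
  -- A non-integrable exponential would make the moment generating function `0` by default, so its
  -- positivity yields integrability.
  have hint : Integrable (fun ω => Real.exp (c * φ.wiener W ω)) μ := by
    rw [← mgf_pos_iff, hm]
    positivity
  rw [← ofReal_integral_eq_lintegral_ofReal hint (ae_of_all _ fun _ => (Real.exp_pos _).le)]
  change ENNReal.ofReal (mgf (φ.wiener W) μ c) = _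
  rw [hm, hv, Real.coe_toNNReal _ (variance_nonneg _ _)]
  congr 2
  ring

end StepFunction

/-! ### Wiener integrals -/

namespace IsWienerIntegral

variable {f g : ℝ → ℝ} {Y Z : Ω → ℝ}

theorem congr_ae (hf : IsWienerIntegral μ W f Y) (h : Y =ᵐ[μ] Z) : IsWienerIntegral μ W f Z := by
  obtain ⟨h1, h2, φ, h3, h4⟩ := hf
  refine ⟨h1, h2.ae_eq h, φ, h3, h4.congr fun n => eLpNorm_congr_ae ?_⟩
  filter_upwards [h] with ω hω
  rw [hω]

theorem add (hW : IsTwoSidedBrownian μ W) (hf : IsWienerIntegral μ W f Y)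
    (hg : IsWienerIntegral μ W g Z) :
    IsWienerIntegral μ W (fun s => f s + g s) (fun ω => Y ω + Z ω) := by
  obtain ⟨f1, f2, φ, f3, f4⟩ := hf
  obtain ⟨g1, g2, ψ, g3, g4⟩ := hg
  refine ⟨f1.add g1, f2.add g2, fun n => (φ n).add (ψ n), ?_, ?_⟩
  · refine tendsto_of_tendsto_of_tendsto_of_le_of_le tendsto_const_nhds (by simpa using f3.add g3)
      (fun _ => zero_le) fun n => ?_
    refine le_trans (le_of_eq ?_) (eLpNorm_add_le
      (((φ n).memLp_eval 2).sub f1).aestronglyMeasurable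
      (((ψ n).memLp_eval 2).sub g1).aestronglyMeasurable one_le_two)
    congr 1
    ext s
    simp only [StepFunction.eval_add, Pi.add_apply]
    ring
  · refine tendsto_of_tendsto_of_tendsto_of_le_of_le tendsto_const_nhds (by simpa using f4.add g4)
      (fun _ => zero_le) fun n => ?_
    refine le_trans (le_of_eq ?_) (eLpNorm_add_le
      (((φ n).memLp_wiener hW).sub f2).aestronglyMeasurable
      (((ψ n).memLp_wiener hW).sub g2).aestronglyMeasurable one_le_two)
    congr 1
    ext s
    simp only [StepFunction.wiener_add, Pi.add_apply]
    ring

theorem const_mul (hf : IsWienerIntegral μ W f Y) (r : ℝ) :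
    IsWienerIntegral μ W (fun s => r * f s) (fun ω => r * Y ω) := by
  obtain ⟨f1, f2, φ, f3, f4⟩ := hf
  refine ⟨f1.const_mul r, f2.const_mul r, fun n => (φ n).smul r, ?_, ?_⟩
  · have := ENNReal.Tendsto.const_mul (a := ‖r‖ₑ) f3 (Or.inr enorm_ne_top)
    rw [mul_zero] at this
    refine this.congr fun n => ?_
    rw [← eLpNorm_const_smul]
    congr 1
    ext s
    simp only [StepFunction.eval_smul, Pi.smul_apply, smul_eq_mul]
    ring
  · have := ENNReal.Tendsto.const_mul (a := ‖r‖ₑ) f4 (Or.inr enorm_ne_top)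
    rw [mul_zero] at this
    refine this.congr fun n => ?_
    rw [← eLpNorm_const_smul]
    congr 1
    ext s
    simp only [StepFunction.wiener_smul, Pi.smul_apply, smul_eq_mul]
    ring

theorem sub (hW : IsTwoSidedBrownian μ W) (hf : IsWienerIntegral μ W f Y)
    (hg : IsWienerIntegral μ W g Z) :
    IsWienerIntegral μ W (fun s => f s - g s) (fun ω => Y ω - Z ω) := by
  convert hf.add hW (hg.const_mul (-1)) using 2 <;> ring

/-- The isometry `eLpNorm_wiener` passes to the limit by the triangle inequality on both sides. Only
this half of it is needed later. -/
theorem eLpNorm_le (hW : IsTwoSidedBrownian μ W) (hf : IsWienerIntegral μ W f Y) :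
    eLpNorm Y 2 μ ≤ eLpNorm f 2 volume := by
  obtain ⟨f1, f2, φ, f3, f4⟩ := hf
  have h : Tendsto (fun n => eLpNorm (fun ω => (φ n).wiener W ω - Y ω) 2 μ +
      (eLpNorm (fun s => (φ n).eval s - f s) 2 volume + eLpNorm f 2 volume)) atTop
      (𝓝 (0 + (0 + eLpNorm f 2 volume))) := f4.add (f3.add tendsto_const_nhds)
  rw [zero_add, zero_add] at h
  refine ge_of_tendsto' h fun n => ?_
  have e1 : eLpNorm Y 2 μ ≤ eLpNorm (fun ω => (φ n).wiener W ω - Y ω) 2 μ +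
      eLpNorm ((φ n).wiener W) 2 μ := by
    have := eLpNorm_sub_le ((φ n).memLp_wiener hW).aestronglyMeasurable
      (((φ n).memLp_wiener hW).sub f2).aestronglyMeasurable one_le_two (p := 2)
    rw [sub_sub_cancel, add_comm] at this
    exact this
  have e2 : eLpNorm (φ n).eval 2 volume ≤ eLpNorm (fun s => (φ n).eval s - f s) 2 volume +
      eLpNorm f 2 volume := by
    have := eLpNorm_add_le (((φ n).memLp_eval 2).sub f1).aestronglyMeasurable
      f1.aestronglyMeasurable one_le_two (p := 2)
    rw [sub_add_cancel] at this
    exact this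
  rw [(φ n).eLpNorm_wiener hW] at e1
  exact e1.trans (add_le_add le_rfl e2)

/-- Diagonal choice: a step function within `1/(n+1)` of the `n`-th pair, in both `L²` norms at
once. -/
theorem of_tendsto (hW : IsTwoSidedBrownian μ W) {u : ℕ → ℝ → ℝ} {X : ℕ → Ω → ℝ}
    (h : ∀ n, IsWienerIntegral μ W (u n) (X n)) (hf : MemLp f 2 volume) (hY : MemLp Y 2 μ)
    (hu : Tendsto (fun n => eLpNorm (fun s => u n s - f s) 2 volume) atTop (𝓝 0))
    (hX : Tendsto (fun n => eLpNorm (fun ω => X n ω - Y ω) 2 μ) atTop (𝓝 0)) :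
    IsWienerIntegral μ W f Y := by
  have hφ : ∀ n : ℕ, ∃ φ : StepFunction,
      eLpNorm (fun s => φ.eval s - u n s) 2 volume ≤ ((n : ℝ≥0∞) + 1)⁻¹ ∧
      eLpNorm (fun ω => φ.wiener W ω - X n ω) 2 μ ≤ ((n : ℝ≥0∞) + 1)⁻¹ := by
    intro n
    obtain ⟨-, -, φ, h3, h4⟩ := h n
    have hpos : (0 : ℝ≥0∞) < ((n : ℝ≥0∞) + 1)⁻¹ := by
      rw [ENNReal.inv_pos]; finiteness
    obtain ⟨k, hk⟩ := ((h3.eventually (gt_mem_nhds hpos)).and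
      (h4.eventually (gt_mem_nhds hpos))).exists
    exact ⟨φ k, hk.1.le, hk.2.le⟩
  choose φ hφ1 hφ2 using hφ
  have h0 : Tendsto (fun n : ℕ => ((n : ℝ≥0∞) + 1)⁻¹) atTop (𝓝 0) := by
    have := (tendsto_add_atTop_iff_nat 1).2 ENNReal.tendsto_inv_nat_nhds_zero
    simpa using this
  refine ⟨hf, hY, φ, ?_, ?_⟩
  · refine tendsto_of_tendsto_of_tendsto_of_le_of_le tendsto_const_nhds (by simpa using h0.add hu)
      (fun _ => zero_le) fun n => ?_
    have := eLpNorm_add_le (((φ n).memLp_eval 2).sub (h n).1).aestronglyMeasurable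
      ((h n).1.sub hf).aestronglyMeasurable one_le_two (p := 2)
    rw [sub_add_sub_cancel] at this
    exact this.trans (add_le_add (hφ1 n) le_rfl)
  · refine tendsto_of_tendsto_of_tendsto_of_le_of_le tendsto_const_nhds (by simpa using h0.add hX)
      (fun _ => zero_le) fun n => ?_
    have := eLpNorm_add_le (((φ n).memLp_wiener hW).sub (h n).2.1).aestronglyMeasurable
      ((h n).2.1.sub hY).aestronglyMeasurable one_le_two (p := 2)
    rw [sub_add_sub_cancel] at this
    exact this.trans (add_le_add (hφ2 n) le_rfl)

/-- Fatou's lemma along an almost surely convergent subsequence of step integrals, whose exponential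
moments are explicit. This avoids identifying the law of the limit. -/
theorem lintegral_exp_le (hW : IsTwoSidedBrownian μ W) (hf : IsWienerIntegral μ W f Y) {r : ℝ}
    (hr : eLpNorm f 2 volume ≤ ENNReal.ofReal r) (c : ℝ) :
    ∫⁻ ω, ENNReal.ofReal (Real.exp (c * Y ω)) ∂μ ≤
      ENNReal.ofReal (Real.exp (c ^ 2 * r ^ 2 / 2)) := by
  obtain ⟨f1, f2, φ, f3, f4⟩ := hf
  obtain ⟨ns, hns, hae⟩ := (tendstoInMeasure_of_tendsto_eLpNorm two_ne_zero
    (fun n => ((φ n).memLp_wiener hW).aestronglyMeasurable) f2.aestronglyMeasurable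
    f4).exists_seq_tendsto_ae
  have hcont : Continuous fun x : ℝ => ENNReal.ofReal (Real.exp (c * x)) :=
    ENNReal.continuous_ofReal.comp (by fun_prop)
  have hnorm : Tendsto (fun n => (eLpNorm (φ n).eval 2 volume).toReal) atTop
      (𝓝 (eLpNorm f 2 volume).toReal) := by
    have h0 := (ENNReal.tendsto_toReal ENNReal.zero_ne_top).comp f3
    refine tendsto_iff_dist_tendsto_zero.2 (squeeze_zero (fun _ => dist_nonneg) (fun n => ?_) h0)
    have m1 := (φ n).memLp_eval 2
    have m2 := m1.sub f1
    have e1 := eLpNorm_add_le m2.aestronglyMeasurable f1.aestronglyMeasurable one_le_two (p := 2)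
    have e2 := eLpNorm_sub_le m1.aestronglyMeasurable m2.aestronglyMeasurable one_le_two (p := 2)
    rw [sub_add_cancel] at e1
    rw [sub_sub_cancel] at e2
    have e1' := ENNReal.toReal_mono (by finiteness [m2.2, f1.2]) e1
    have e2' := ENNReal.toReal_mono (by finiteness [m2.2, m1.2]) e2
    rw [ENNReal.toReal_add m2.2.ne f1.2.ne] at e1'
    rw [ENNReal.toReal_add m1.2.ne m2.2.ne] at e2'
    rw [Real.dist_eq, abs_le]
    change _ ≤ _ ∧ _ ≤ (eLpNorm ((φ n).eval - f) 2 volume).toReal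
    constructor
    · change -(eLpNorm ((φ n).eval - f) 2 volume).toReal ≤ _
      linarith
    · linarith
  have hv : (eLpNorm f 2 volume).toReal ^ 2 ≤ r ^ 2 := by
    have h1 := ENNReal.toReal_mono ENNReal.ofReal_ne_top hr
    rw [ENNReal.toReal_ofReal'] at h1
    -- The sign of `r` is not fixed: a negative `r` forces the norm to be `0`.
    have h2 : max r 0 ≤ |r| := max_le (le_abs_self r) (abs_nonneg r)
    rw [← sq_abs r]
    exact pow_le_pow_left₀ ENNReal.toReal_nonneg (h1.trans h2) 2
  calc ∫⁻ ω, ENNReal.ofReal (Real.exp (c * Y ω)) ∂μ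
      = ∫⁻ ω, liminf (fun n => ENNReal.ofReal (Real.exp (c * (φ (ns n)).wiener W ω))) atTop ∂μ := by
        refine lintegral_congr_ae ?_
        filter_upwards [hae] with ω hω
        exact ((hcont.tendsto _).comp hω).liminf_eq.symm
    _ ≤ liminf (fun n => ∫⁻ ω, ENNReal.ofReal (Real.exp (c * (φ (ns n)).wiener W ω)) ∂μ) atTop :=
        lintegral_liminf_le' fun n =>
          hcont.measurable.comp_aemeasurable ((φ (ns n)).hasGaussianLaw_wiener hW).aemeasurable
    _ = ENNReal.ofReal (Real.exp (c ^ 2 * (eLpNorm f 2 volume).toReal ^ 2 / 2)) := by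
        simp_rw [fun n => (φ (ns n)).lintegral_exp_wiener hW c]
        have hcont' : Continuous fun x : ℝ => ENNReal.ofReal (Real.exp (c ^ 2 * x ^ 2 / 2)) :=
          ENNReal.continuous_ofReal.comp (by fun_prop)
        exact ((hcont'.tendsto _).comp (hnorm.comp hns.tendsto_atTop)).liminf_eq
    _ ≤ ENNReal.ofReal (Real.exp (c ^ 2 * r ^ 2 / 2)) := by gcongr

/-- `e^{c|y|} ≤ e^{cy} + e^{-cy}`, and the one-sided bound is even in `c`. -/
theorem lintegral_exp_abs_le (hW : IsTwoSidedBrownian μ W) (hf : IsWienerIntegral μ W f Y) {r : ℝ}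
    (hr : eLpNorm f 2 volume ≤ ENNReal.ofReal r) (c : ℝ) :
    ∫⁻ ω, ENNReal.ofReal (Real.exp (c * |Y ω|)) ∂μ ≤
      2 * ENNReal.ofReal (Real.exp (c ^ 2 * r ^ 2 / 2)) := by
  have h1 := hf.lintegral_exp_le hW hr c
  have h2 := hf.lintegral_exp_le hW hr (-c)
  rw [neg_sq] at h2
  rw [two_mul]
  refine le_trans ?_ (add_le_add h1 h2)
  rw [← lintegral_add_left']
  · refine lintegral_mono fun ω => ?_
    rcases abs_cases (Y ω) with ⟨h, -⟩ | ⟨h, -⟩ <;> rw [h]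
    · exact le_self_add
    · rw [mul_neg, ← neg_mul]
      exact le_add_self
  · have := hf.2.1.aestronglyMeasurable.aemeasurable
    fun_prop

/-- Moments of Wiener integrals are bounded by powers of the norm of the integrand. -/
theorem lintegral_rpow_le (hW : IsTwoSidedBrownian μ W) (hf : IsWienerIntegral μ W f Y) {r : ℝ}
    (h0 : 0 < r) (hr : eLpNorm f 2 volume ≤ ENNReal.ofReal r) {p : ℝ} (hp : 0 < p) :
    ∫⁻ ω, ‖Y ω‖ₑ ^ p ∂μ ≤
      ENNReal.ofReal (2 * p ^ p * Real.exp (1 / 2)) * ENNReal.ofReal r ^ p := by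
  -- From `u ≤ e^u` at `u = |y| / (r p)`. With the scale `r⁻¹` the exponential moment no longer
  -- depends on `r`, so the whole dependence on the kernel is the factor `r ^ p`.
  have key : ∀ y : ℝ, |y| ^ p ≤ p ^ p * r ^ p * Real.exp (r⁻¹ * |y|) := by
    intro y
    have hx : 0 ≤ r⁻¹ * |y| / p := by positivity
    have h1 : (r⁻¹ * |y| / p) ^ p ≤ Real.exp (r⁻¹ * |y|) := by
      calc (r⁻¹ * |y| / p) ^ p ≤ Real.exp (r⁻¹ * |y| / p) ^ p :=
            Real.rpow_le_rpow hx (by linarith [Real.add_one_le_exp (r⁻¹ * |y| / p)]) hp.le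
        _ = Real.exp (r⁻¹ * |y|) := by rw [← Real.exp_mul, div_mul_cancel₀ _ hp.ne']
    calc |y| ^ p = (p * r * (r⁻¹ * |y| / p)) ^ p := by congr 1; field_simp
      _ = p ^ p * r ^ p * (r⁻¹ * |y| / p) ^ p := by
          rw [Real.mul_rpow (by positivity) hx, Real.mul_rpow hp.le h0.le]
      _ ≤ _ := by gcongr
  have h2 := hf.lintegral_exp_abs_le hW hr r⁻¹
  have h3 : (r⁻¹) ^ 2 * r ^ 2 = 1 := by rw [← mul_pow, inv_mul_cancel₀ h0.ne', one_pow]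
  rw [h3] at h2
  calc ∫⁻ ω, ‖Y ω‖ₑ ^ p ∂μ
      ≤ ∫⁻ ω, ENNReal.ofReal (p ^ p * r ^ p) * ENNReal.ofReal (Real.exp (r⁻¹ * |Y ω|)) ∂μ := by
        refine lintegral_mono fun ω => ?_
        rw [← ENNReal.ofReal_mul (by positivity), Real.enorm_eq_ofReal_abs,
          ENNReal.ofReal_rpow_of_nonneg (abs_nonneg _) hp.le]
        exact ENNReal.ofReal_le_ofReal (key _)
    _ = ENNReal.ofReal (p ^ p * r ^ p) * ∫⁻ ω, ENNReal.ofReal (Real.exp (r⁻¹ * |Y ω|)) ∂μ :=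
        lintegral_const_mul' _ _ ENNReal.ofReal_ne_top
    _ ≤ ENNReal.ofReal (p ^ p * r ^ p) * (2 * ENNReal.ofReal (Real.exp (1 / 2))) := by gcongr
    _ = _ := by
        rw [ENNReal.ofReal_rpow_of_nonneg h0.le hp.le, ← ENNReal.ofReal_mul (by positivity),
          show (2 : ℝ≥0∞) = ENNReal.ofReal 2 by simp, ← ENNReal.ofReal_mul (by positivity),
          ← ENNReal.ofReal_mul (by positivity)]
        congr 1
        ring

/-- The Wiener integral of a function that vanishes after time `t` is known at time `t`. -/
theorem measurable_naturalFiltration {T : ℝ} {B : ℝ≥0 → Ω → ℝ} (h : IsDrivingPair μ W B)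
    (hf : IsWienerIntegral μ W f Y) (hY : Measurable Y) (t : Icc (0 : ℝ) T)
    (hft : ∀ s, (t : ℝ) < s → f s = 0) : Measurable[naturalFiltration T h t] Y := by
  have hW := h.brownian_W
  obtain ⟨f1, f2, φ, f3, f4⟩ := hf
  set ψ := fun n => (φ n).cutoff t with hψ
  have g3 : Tendsto (fun n => eLpNorm (fun s => (ψ n).eval s - f s) 2 volume) atTop (𝓝 0) := by
    refine tendsto_of_tendsto_of_tendsto_of_le_of_le tendsto_const_nhds f3 (fun _ => zero_le)
      fun n => eLpNorm_mono fun s => ?_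
    rw [hψ, StepFunction.eval_cutoff]
    by_cases hs : s ≤ (t : ℝ)
    · rw [indicator_of_mem (show s ∈ Iic (t : ℝ) from hs)]
    · rw [indicator_of_notMem (show s ∉ Iic (t : ℝ) from hs), hft s (not_le.1 hs)]
      simp
  -- `ψ n` and `φ n` both converge to `f`; since their difference is a step function, the isometry
  -- carries this over to the integrals.
  have g4 : Tendsto (fun n => eLpNorm (fun ω => (ψ n).wiener W ω - Y ω) 2 μ) atTop (𝓝 0) := by
    refine tendsto_of_tendsto_of_tendsto_of_le_of_le tendsto_const_nhds
      (by simpa using (g3.add f3).add f4) (fun _ => zero_le) fun n => ?_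
    have e1 := eLpNorm_add_le (((ψ n).memLp_wiener hW).sub ((φ n).memLp_wiener hW)).aestronglyMeasurable
      (((φ n).memLp_wiener hW).sub f2).aestronglyMeasurable one_le_two (p := 2)
    rw [sub_add_sub_cancel] at e1
    refine e1.trans (add_le_add ?_ le_rfl)
    have e2 : (ψ n).wiener W - (φ n).wiener W = ((ψ n).add ((φ n).smul (-1))).wiener W := by
      ext ω
      rw [StepFunction.wiener_add, StepFunction.wiener_smul, Pi.sub_apply]
      ring
    have e3 : ((ψ n).add ((φ n).smul (-1))).eval =
        ((ψ n).eval - f) - ((φ n).eval - f) := by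
      ext ω
      rw [StepFunction.eval_add, StepFunction.eval_smul]
      simp only [Pi.sub_apply]
      ring
    rw [e2, StepFunction.eLpNorm_wiener _ hW, e3]
    exact eLpNorm_sub_le (((ψ n).memLp_eval 2).sub f1).aestronglyMeasurable
      (((φ n).memLp_eval 2).sub f1).aestronglyMeasurable one_le_two
  obtain ⟨ns, -, hae⟩ := (tendstoInMeasure_of_tendsto_eLpNorm two_ne_zero
    (fun n => ((ψ n).memLp_wiener hW).aestronglyMeasurable) f2.aestronglyMeasurable
    g4).exists_seq_tendsto_ae
  have hle := (naturalFiltration T h).le t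
  have hψm : ∀ n, Measurable[naturalFiltration T h t] ((ψ n).wiener W) := by
    intro n
    have hWs : ∀ s : ℝ, s ≤ t → Measurable[naturalFiltration T h t] (W s) := by
      intro s hs
      refine measurable_iff_comap_le.2 ?_
      exact (le_iSup₂ (f := fun (s : ℝ) (_ : s ≤ (t : ℝ)) =>
        MeasurableSpace.comap (W s) inferInstance) s hs).trans (le_sup_left.trans le_sup_left)
    unfold StepFunction.wiener
    refine @Finset.measurable_sum _ _ _ _ _ _ (naturalFiltration T h t) _ _ fun i _ => ?_
    exact Measurable.const_mul (Measurable.sub (hWs _ (min_le_right _ _))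
      (hWs _ (min_le_right _ _))) _
  set N := toMeasurable μ {ω | ¬ Tendsto (fun i => (ψ (ns i)).wiener W ω) atTop (𝓝 (Y ω))} with hN
  have hN0 : μ N = 0 := by rw [hN, measure_toMeasurable]; exact hae
  have hnull : ∀ S, MeasurableSet S → μ S = 0 → MeasurableSet[naturalFiltration T h t] S := by
    intro S h1 h2
    exact (le_sup_right : _ ≤ (naturalFiltration T h t : MeasurableSpace Ω)) S
      (MeasurableSpace.measurableSet_generateFrom ⟨h1, h2⟩)
  have hNm : MeasurableSet N := measurableSet_toMeasurable _ _
  have hNt := hnull N hNm hN0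
  have hZ : Measurable[naturalFiltration T h t] (Nᶜ.indicator Y) := by
    refine @measurable_of_tendsto_metrizable _ _ (naturalFiltration T h t) _ _ _ _
      (fun i => Nᶜ.indicator ((ψ (ns i)).wiener W)) _ (fun i => ?_) ?_
    · exact (hψm (ns i)).indicator hNt.compl
    · refine tendsto_pi_nhds.2 fun ω => ?_
      by_cases hω : ω ∈ N
      · simp [hω]
      · have h1 : Tendsto (fun i => (ψ (ns i)).wiener W ω) atTop (𝓝 (Y ω)) := by
          by_contra h2
          exact hω (subset_toMeasurable _ _ h2)
        simpa [hω] using h1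
  intro S hS
  -- Off the null set `N` the variable is a limit of variables known at time `t`. On `N` any
  -- measurable event is null and thus belongs to the completed filtration; measurability of `Y` for
  -- the ambient σ-algebra enters here.
  have e : Y ⁻¹' S = (Nᶜ.indicator Y ⁻¹' S ∩ Nᶜ) ∪ (Y ⁻¹' S ∩ N) := by
    ext ω
    by_cases hω : ω ∈ N <;> simp [hω]
  rw [e]
  refine MeasurableSet.union ((hZ hS).inter hNt.compl) (hnull _ ((hY hS).inter hNm) ?_)
  exact measure_mono_null inter_subset_right hN0

end IsWienerIntegral

end WienerIntegral

/-! ### The Mandelbrot-Van Ness kernel and its derivatives in the Hurst parameter -/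

section Kernel

/-- The function `x_+^a (log x)^j`, the `j`-th derivative of `x_+^a` in `a`. -/
def posPowLog (j : ℕ) (a x : ℝ) : ℝ := if 0 < x then x ^ a * Real.log x ^ j else 0

/-- The `j`-th derivative in `a` of the unnormalized kernel `(t-s)_+^a - (-s)_+^a`. -/
def rawKernel (j : ℕ) (a t s : ℝ) : ℝ := posPowLog j a (t - s) - posPowLog j a (-s)

theorem kernel_eq (H t s : ℝ) : kernel H t s = normConst H * rawKernel 0 (H - 1 / 2) t s := by
  simp [kernel, rawKernel, posPowLog, posPow]

theorem measurable_posPowLog (j : ℕ) (a : ℝ) : Measurable (posPowLog j a) :=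
  Measurable.ite measurableSet_Ioi (by fun_prop) measurable_const

theorem measurable_rawKernel (j : ℕ) (a t : ℝ) : Measurable (rawKernel j a t) :=
  ((measurable_posPowLog j a).comp (measurable_const.sub measurable_id)).sub
    ((measurable_posPowLog j a).comp measurable_neg)

theorem hasDerivAt_posPowLog (j : ℕ) (a x : ℝ) :
    HasDerivAt (fun a => posPowLog j a x) (posPowLog (j + 1) a x) a := by
  by_cases hx : 0 < x
  · simp only [posPowLog, hx, if_true]
    have h := ((hasDerivAt_id a).const_rpow hx).mul_const (Real.log x ^ j)
    refine h.congr_deriv ?_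
    simp only [id, mul_one, pow_succ]
    ring
  · simpa only [posPowLog, hx, if_false] using hasDerivAt_const a (0 : ℝ)

theorem hasDerivAt_rawKernel (j : ℕ) (a t s : ℝ) :
    HasDerivAt (fun a => rawKernel j a t s) (rawKernel (j + 1) a t s) a :=
  (hasDerivAt_posPowLog j a _).sub (hasDerivAt_posPowLog j a _)

/-- Each factor `x ^ (-(e/2))` absorbs one logarithm. The quantity `(1 + 2/e) x ^ (-(e/2))` is at
least `1` and at least `|log x|`, so its square dominates the powers `j = 0, 1, 2` together. -/
theorem abs_log_pow_le_of_le_one {e x : ℝ} (he : 0 < e) (hx : 0 < x) (hx1 : x ≤ 1) {j : ℕ}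
    (hj : j ≤ 2) : |Real.log x| ^ j ≤ (1 + 2 / e) ^ 2 * x ^ (-e) := by
  have h1 : 1 ≤ x ^ (-(e / 2)) := Real.one_le_rpow_of_pos_of_le_one_of_nonpos hx hx1 (by linarith)
  have h2 : |Real.log x| ≤ 2 / e * x ^ (-(e / 2)) := by
    have h := (Real.abs_log_mul_self_rpow_lt x (e / 2) hx hx1 (by positivity)).le
    rw [abs_mul, abs_of_nonneg (Real.rpow_nonneg hx.le _)] at h
    rw [Real.rpow_neg hx.le, ← div_eq_mul_inv, le_div_iff₀ (by positivity)]
    refine h.trans (le_of_eq ?_)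
    field_simp
  have h3 : 0 < 2 / e := by positivity
  have hy1 : 1 ≤ (1 + 2 / e) * x ^ (-(e / 2)) := by nlinarith
  have hy2 : |Real.log x| ≤ (1 + 2 / e) * x ^ (-(e / 2)) := by nlinarith
  have hy : ((1 + 2 / e) * x ^ (-(e / 2))) ^ 2 = (1 + 2 / e) ^ 2 * x ^ (-e) := by
    rw [mul_pow, ← Real.rpow_natCast (x ^ _), ← Real.rpow_mul hx.le]
    congr 2
    push_cast
    ring
  rw [← hy]
  exact (pow_le_pow_left₀ (abs_nonneg _) hy2 j).trans (pow_le_pow_right₀ hy1 hj)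

theorem abs_log_pow_le_of_one_le {e x : ℝ} (he : 0 < e) (hx1 : 1 ≤ x) {j : ℕ}
    (hj : j ≤ 2) : |Real.log x| ^ j ≤ (1 + 2 / e) ^ 2 * x ^ e := by
  have hx : 0 < x := by linarith
  have := abs_log_pow_le_of_le_one he (inv_pos.2 hx) (inv_le_one_of_one_le₀ hx1) hj
  rwa [Real.log_inv, abs_neg, Real.inv_rpow hx.le, Real.rpow_neg hx.le, inv_inv] at this

/-- The worst exponent is `-d` on `(0, 1]` and `d` on `[1, R]`, at the price of an extra `e` for the
logarithms. Adding the two bounds gives a majorant independent of `a` and `j`. -/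
theorem abs_posPowLog_le {d e R a x : ℝ} (he : 0 < e) (hR : 1 ≤ R) (ha : |a| ≤ d) {j : ℕ}
    (hj : j ≤ 2) (hx : x ≤ R) :
    |posPowLog j a x| ≤
      (Ioc 0 R).indicator (fun x => (1 + 2 / e) ^ 2 * (x ^ (-(d + e)) + R ^ (d + e))) x := by
  have hd : 0 ≤ d := (abs_nonneg a).trans ha
  obtain ⟨ha1, ha2⟩ := abs_le.1 ha
  by_cases h0 : 0 < x
  · rw [indicator_of_mem (show x ∈ Ioc 0 R from ⟨h0, hx⟩), posPowLog, if_pos h0, abs_mul, abs_pow,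
      abs_of_nonneg (Real.rpow_nonneg h0.le _)]
    have hC : 0 < (1 + 2 / e) ^ 2 := by positivity
    rcases le_total x 1 with h1 | h1
    · calc x ^ a * |Real.log x| ^ j ≤ x ^ (-d) * ((1 + 2 / e) ^ 2 * x ^ (-e)) := by
            gcongr ?_ * ?_
            · exact Real.rpow_le_rpow_of_exponent_ge h0 h1 ha1
            · exact abs_log_pow_le_of_le_one he h0 h1 hj
        _ = (1 + 2 / e) ^ 2 * x ^ (-(d + e)) := by
            rw [neg_add, Real.rpow_add h0]
            ring
        _ ≤ _ := by
            gcongr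
            exact le_add_of_nonneg_right (by positivity)
    · calc x ^ a * |Real.log x| ^ j ≤ x ^ d * ((1 + 2 / e) ^ 2 * x ^ e) := by
            gcongr ?_ * ?_
            · exact Real.rpow_le_rpow_of_exponent_le h1 ha2
            · exact abs_log_pow_le_of_one_le he h1 hj
        _ = (1 + 2 / e) ^ 2 * x ^ (d + e) := by
            rw [Real.rpow_add h0]
            ring
        _ ≤ (1 + 2 / e) ^ 2 * R ^ (d + e) := by gcongr
        _ ≤ _ := by
            gcongr
            exact le_add_of_nonneg_left (by positivity)
  · rw [posPowLog, if_neg h0, indicator_of_notMem (fun h => h0 h.1), abs_zero]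

/-- Mean value inequality: differentiating in `x` gains one power of decay, and as `d + e < 1` the
bound on the derivative is largest at the left endpoint. The resulting `x ^ (d + e - 1)` is square
integrable at infinity when `d + e < 1/2`. -/
theorem abs_posPowLog_sub_le {d e a x y : ℝ} (he : 0 < e) (hde : d + e < 1) (ha : |a| ≤ d) {j : ℕ}
    (hj : j ≤ 2) (hx : 1 ≤ x) (hxy : x ≤ y) :
    |posPowLog j a y - posPowLog j a x| ≤
      (d + 2) * (1 + 2 / e) ^ 2 * x ^ (d + e - 1) * (y - x) := by
  have hd : 0 ≤ d := (abs_nonneg a).trans ha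
  obtain ⟨ha1, ha2⟩ := abs_le.1 ha
  have hder : ∀ z ∈ Icc x y, HasDerivWithinAt (posPowLog j a)
      (a * z ^ (a - 1) * Real.log z ^ j + z ^ a * (j * Real.log z ^ (j - 1) * z⁻¹)) (Icc x y) z := by
    intro z hz
    have hz0 : 0 < z := by linarith [hz.1]
    have h1 : HasDerivAt (fun z => z ^ a * Real.log z ^ j)
        (a * z ^ (a - 1) * Real.log z ^ j + z ^ a * (j * Real.log z ^ (j - 1) * z⁻¹)) z :=
      (Real.hasDerivAt_rpow_const (Or.inl hz0.ne')).mul ((Real.hasDerivAt_log hz0.ne').pow j)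
    refine (h1.congr_of_eventuallyEq ?_).hasDerivWithinAt
    filter_upwards [lt_mem_nhds hz0] with w hw
    rw [posPowLog, if_pos hw]
  have hbd : ∀ z ∈ Icc x y,
      ‖a * z ^ (a - 1) * Real.log z ^ j + z ^ a * (j * Real.log z ^ (j - 1) * z⁻¹)‖ ≤
        (d + 2) * (1 + 2 / e) ^ 2 * x ^ (d + e - 1) := by
    intro z hz
    have hz1 : 1 ≤ z := hx.trans hz.1
    have hz0 : 0 < z := by linarith
    have e1 : a * z ^ (a - 1) * Real.log z ^ j + z ^ a * (j * Real.log z ^ (j - 1) * z⁻¹) =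
        z ^ (a - 1) * (a * Real.log z ^ j + j * Real.log z ^ (j - 1)) := by
      rw [Real.rpow_sub_one hz0.ne']
      ring
    have hj' : (j : ℝ) ≤ 2 := by exact_mod_cast hj
    have l1 := abs_log_pow_le_of_one_le he hz1 hj
    have l2 := abs_log_pow_le_of_one_le he hz1 (show j - 1 ≤ 2 by omega)
    have e2 : |a * Real.log z ^ j + j * Real.log z ^ (j - 1)| ≤
        (d + 2) * ((1 + 2 / e) ^ 2 * z ^ e) := by
      calc |a * Real.log z ^ j + j * Real.log z ^ (j - 1)|
          ≤ |a| * |Real.log z| ^ j + j * |Real.log z| ^ (j - 1) := by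
            refine (abs_add_le _ _).trans (le_of_eq ?_)
            rw [abs_mul, abs_mul, abs_pow, abs_pow, Nat.abs_cast]
        _ ≤ d * ((1 + 2 / e) ^ 2 * z ^ e) + 2 * ((1 + 2 / e) ^ 2 * z ^ e) := by gcongr
        _ = _ := by ring
    rw [e1, Real.norm_eq_abs, abs_mul, abs_of_nonneg (Real.rpow_nonneg hz0.le _)]
    calc z ^ (a - 1) * |a * Real.log z ^ j + j * Real.log z ^ (j - 1)|
        ≤ z ^ (d - 1) * ((d + 2) * ((1 + 2 / e) ^ 2 * z ^ e)) := by
          gcongr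
      _ = (d + 2) * (1 + 2 / e) ^ 2 * z ^ (d + e - 1) := by
          rw [show d + e - 1 = (d - 1) + e by ring, Real.rpow_add hz0]
          ring
      _ ≤ (d + 2) * (1 + 2 / e) ^ 2 * x ^ (d + e - 1) := by
          gcongr ?_ * ?_
          exact Real.rpow_le_rpow_of_nonpos (by linarith) hz.1 (by linarith)
  have := (convex_Icc x y).norm_image_sub_le_of_norm_hasDerivWithin_le hder hbd
    (left_mem_Icc.2 hxy) (right_mem_Icc.2 hxy)
  rwa [Real.norm_eq_abs, Real.norm_eq_abs, abs_of_nonneg (sub_nonneg.2 hxy)] at this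

theorem memLp_indicator_Ioc_rpow_add {b : ℝ} (hb : b < 1 / 2) (R C D : ℝ) :
    MemLp ((Ioc 0 R).indicator fun x : ℝ => C * (x ^ (-b) + D)) 2 volume := by
  rw [memLp_indicator_iff_restrict measurableSet_Ioc]
  have hc : MemLp (fun _ : ℝ => D) 2 (volume.restrict (Ioc 0 R)) := memLp_const _
  suffices hp : MemLp (fun x : ℝ => x ^ (-b)) 2 (volume.restrict (Ioc 0 R)) from
    (hp.add hc).const_mul _
  rw [memLp_two_iff_integrable_sq (Measurable.aestronglyMeasurable (by fun_prop))]
  rcases le_or_gt 0 R with hR | hR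
  · have h1 : IntegrableOn (fun x : ℝ => x ^ (-(2 * b))) (Ioc 0 R) :=
      (intervalIntegrable_iff_integrableOn_Ioc_of_le hR).1
        (intervalIntegral.intervalIntegrable_rpow' (by linarith))
    refine h1.congr_fun (fun x hx => ?_) measurableSet_Ioc
    simp only
    rw [← Real.rpow_natCast, ← Real.rpow_mul hx.1.le]
    congr 1
    push_cast
    ring
  · simp [Ioc_eq_empty_of_le hR.le]

theorem memLp_indicator_Ioi_rpow {b : ℝ} (hb : b < -(1 / 2)) (C : ℝ) :
    MemLp ((Ioi 1).indicator fun x : ℝ => C * x ^ b) 2 volume := by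
  rw [memLp_indicator_iff_restrict measurableSet_Ioi]
  suffices hp : MemLp (fun x : ℝ => x ^ b) 2 (volume.restrict (Ioi 1)) from hp.const_mul _
  rw [memLp_two_iff_integrable_sq (Measurable.aestronglyMeasurable (by fun_prop))]
  have h1 : IntegrableOn (fun x : ℝ => x ^ (2 * b)) (Ioi 1) :=
    integrableOn_Ioi_rpow_of_lt (by linarith) one_pos
  refine h1.congr_fun (fun x hx => ?_) measurableSet_Ioi
  have hx0 : (0 : ℝ) ≤ x := zero_le_one.trans (le_of_lt hx)
  simp only
  rw [← Real.rpow_natCast, ← Real.rpow_mul hx0]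
  congr 1
  push_cast
  ring

/-- The maps `s ↦ t - s` and `s ↦ -s` preserve Lebesgue measure, so the bound is the same for every
`t`. The added `1` only makes `G` positive. -/
theorem exists_eLpNorm_reflect_le {M N : ℝ → ℝ} (hM : MemLp M 2 volume) (hN : MemLp N 2 volume) :
    ∃ G : ℝ, 0 < G ∧ ∀ t, MemLp (fun s => M (t - s) + M (-s) + N (-s)) 2 volume ∧
      eLpNorm (fun s => M (t - s) + M (-s) + N (-s)) 2 volume ≤ ENNReal.ofReal G := by
  have hmp := fun t : ℝ => Measure.measurePreserving_sub_left (volume : Measure ℝ) t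
  have hng : MeasurePreserving (fun x : ℝ => -x) := Measure.measurePreserving_neg _
  have hMt : ∀ t, MemLp (fun s => M (t - s)) 2 volume := fun t => hM.comp_measurePreserving (hmp t)
  have hM0 : MemLp (fun s => M (-s)) 2 volume := hM.comp_measurePreserving hng
  have hN0 : MemLp (fun s => N (-s)) 2 volume := hN.comp_measurePreserving hng
  have eM : ∀ t, eLpNorm (fun s => M (t - s)) 2 volume = eLpNorm M 2 volume :=
    fun t => eLpNorm_comp_measurePreserving hM.aestronglyMeasurable (hmp t)
  have eM0 : eLpNorm (fun s => M (-s)) 2 volume = eLpNorm M 2 volume :=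
    eLpNorm_comp_measurePreserving hM.aestronglyMeasurable hng
  have eN0 : eLpNorm (fun s => N (-s)) 2 volume = eLpNorm N 2 volume :=
    eLpNorm_comp_measurePreserving hN.aestronglyMeasurable hng
  have hfin : eLpNorm M 2 volume + eLpNorm M 2 volume + eLpNorm N 2 volume ≠ ∞ :=
    ENNReal.add_ne_top.2 ⟨ENNReal.add_ne_top.2 ⟨hM.2.ne, hM.2.ne⟩, hN.2.ne⟩
  refine ⟨(eLpNorm M 2 volume + eLpNorm M 2 volume + eLpNorm N 2 volume).toReal + 1,
    by positivity, fun t => ⟨((hMt t).add hM0).add hN0, ?_⟩⟩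
  calc _ ≤ eLpNorm M 2 volume + eLpNorm M 2 volume + eLpNorm N 2 volume := by
        refine (eLpNorm_add_le ((hMt t).add hM0).aestronglyMeasurable
          hN0.aestronglyMeasurable one_le_two).trans (add_le_add ?_ eN0.le)
        exact (eLpNorm_add_le (hMt t).aestronglyMeasurable
          hM0.aestronglyMeasurable one_le_two).trans (add_le_add (eM t).le eM0.le)
    _ = ENNReal.ofReal (eLpNorm M 2 volume + eLpNorm M 2 volume + eLpNorm N 2 volume).toReal :=
        (ENNReal.ofReal_toReal hfin).symm
    _ ≤ _ := ENNReal.ofReal_le_ofReal (by linarith)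

/-- A common square integrable bound for the derivatives up to order two of the kernels
`(t-s)_+^a - (-s)_+^a`, over `|a| ≤ d < 1/2` and `0 ≤ t ≤ T`. -/
theorem exists_rawKernel_majorant {T d : ℝ} (hT : 0 ≤ T) (hd0 : 0 ≤ d) (hd : d < 1 / 2) :
    ∃ (G : ℝ) (g : ℝ → ℝ → ℝ), 0 < G ∧ (∀ t, MemLp (g t) 2 volume) ∧
      (∀ t, eLpNorm (g t) 2 volume ≤ ENNReal.ofReal G) ∧
      ∀ t ∈ Icc 0 T, ∀ a, |a| ≤ d → ∀ j ≤ 2, ∀ s, |rawKernel j a t s| ≤ g t s := by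
  -- With `d + e < 1/2` the singularity `x ^ (-(d+e))` at `0` and the tail `x ^ (d+e-1)` at infinity
  -- are both square integrable.
  obtain ⟨e, he0, hde⟩ : ∃ e : ℝ, 0 < e ∧ d + e < 1 / 2 :=
    ⟨(1 / 2 - d) / 2, by linarith, by linarith⟩
  -- For `s ≥ -1` both `t - s` and `-s` are at most `T + 1`.
  obtain ⟨R, hRT⟩ : ∃ R : ℝ, R = T + 1 := ⟨_, rfl⟩
  have hR : 1 ≤ R := by linarith
  obtain ⟨M, hM⟩ : ∃ M : ℝ → ℝ, M = (Ioc 0 R).indicator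
    (fun x => (1 + 2 / e) ^ 2 * (x ^ (-(d + e)) + R ^ (d + e))) := ⟨_, rfl⟩
  obtain ⟨N, hN⟩ : ∃ N : ℝ → ℝ, N = (Ioi 1).indicator
    (fun x => (d + 2) * (1 + 2 / e) ^ 2 * T * x ^ (d + e - 1)) := ⟨_, rfl⟩
  have hM0 : ∀ x, 0 ≤ M x := fun x => hM ▸ indicator_nonneg (fun x hx => by
    have := hx.1.le
    positivity) x
  have hN0 : ∀ x, 0 ≤ N x := fun x => hN ▸ indicator_nonneg (fun x hx => by
    have : (0 : ℝ) ≤ x := zero_le_one.trans (le_of_lt hx)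
    positivity) x
  obtain ⟨G, hG0, hG⟩ := exists_eLpNorm_reflect_le
    (hM ▸ memLp_indicator_Ioc_rpow_add hde R ((1 + 2 / e) ^ 2) (R ^ (d + e)) : MemLp M 2 volume)
    (hN ▸ memLp_indicator_Ioi_rpow (by linarith) _ : MemLp N 2 volume)
  refine ⟨G, fun t s => M (t - s) + M (-s) + N (-s), hG0, fun t => (hG t).1, fun t => (hG t).2, ?_⟩
  · intro t ht a ha j hj s
    simp only
    -- For `s ≥ -1` the two powers are estimated separately. For `s < -1` neither need be square
    -- integrable alone, and their cancellation is used.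
    rcases le_or_gt (-1) s with hs | hs
    · have h1 : |posPowLog j a (t - s)| ≤ M (t - s) :=
        hM ▸ abs_posPowLog_le he0 hR ha hj (by linarith [ht.2])
      have h2 : |posPowLog j a (-s)| ≤ M (-s) :=
        hM ▸ abs_posPowLog_le he0 hR ha hj (by linarith)
      have h3 : |rawKernel j a t s| ≤ |posPowLog j a (t - s)| + |posPowLog j a (-s)| :=
        abs_sub _ _
      linarith [hN0 (-s)]
    · have h1 := abs_posPowLog_sub_le he0 (by linarith) ha hj (show (1 : ℝ) ≤ -s by linarith)
        (show -s ≤ t - s by linarith [ht.1])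
      have h2 : N (-s) = (d + 2) * (1 + 2 / e) ^ 2 * T * (-s) ^ (d + e - 1) :=
        hN ▸ indicator_of_mem (show -s ∈ Ioi (1 : ℝ) from by simp only [mem_Ioi]; linarith) _
      have h3 : 0 ≤ (-s) ^ (d + e - 1) := Real.rpow_nonneg (by linarith) _
      have h4 : |rawKernel j a t s| ≤ N (-s) := by
        rw [h2, mul_right_comm _ T]
        refine h1.trans ?_
        gcongr
        linarith [ht.2]
      linarith [hM0 (t - s), hM0 (-s)]

end Kernel

/-! ### Differentiability of the kernel in the Hurst parameter, in `L²(ℝ)`. -/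

section KernelBounds

theorem abs_rawKernel_sub_le {d C t s : ℝ} (j : ℕ)
    (hC : ∀ a, |a| ≤ d → |rawKernel (j + 1) a t s| ≤ C) {a a' : ℝ} (ha : |a| ≤ d)
    (ha' : |a'| ≤ d) : |rawKernel j a' t s - rawKernel j a t s| ≤ C * |a' - a| :=
  (convex_Icc (-d) d).norm_image_sub_le_of_norm_hasDerivWithin_le
    (fun x _ => (hasDerivAt_rawKernel j x t s).hasDerivWithinAt)
    (fun x hx => hC x (abs_le.2 hx)) (abs_le.1 ha) (abs_le.1 ha')

/-- Mean value inequality for `x ↦ rawKernel 0 x t s - x * rawKernel 1 a t s`, whose derivative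
`rawKernel 1 x t s - rawKernel 1 a t s` is at most `C |a' - a|` on the segment. The sharp factor
`1/2` is not needed. -/
theorem abs_rawKernel_taylor_le {d C t s : ℝ}
    (hC : ∀ a, |a| ≤ d → |rawKernel 2 a t s| ≤ C) {a a' : ℝ} (ha : |a| ≤ d) (ha' : |a'| ≤ d) :
    |rawKernel 0 a' t s - rawKernel 0 a t s - (a' - a) * rawKernel 1 a t s| ≤
      C * |a' - a| ^ 2 := by
  have h := (convex_uIcc a a').norm_image_sub_le_of_norm_hasDerivWithin_le
    (f := fun x => rawKernel 0 x t s - x * rawKernel 1 a t s) (C := C * |a' - a|)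
    (f' := fun x => rawKernel 1 x t s - 1 * rawKernel 1 a t s)
    (fun x _ => ((hasDerivAt_rawKernel 0 x t s).sub
      ((hasDerivAt_id x).mul_const _)).hasDerivWithinAt)
    (fun x hx => ?_) left_mem_uIcc right_mem_uIcc
  · rw [Real.norm_eq_abs, Real.norm_eq_abs] at h
    rw [sq, ← mul_assoc]
    refine le_trans (le_of_eq ?_) h
    congr 1
    ring
  · have hx' : |x| ≤ d := by
      have h1 := (uIcc_subset_Icc (abs_le.1 ha) (abs_le.1 ha') : uIcc a a' ⊆ Icc (-d) d) hx
      exact abs_le.2 h1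
    have h1 := abs_rawKernel_sub_le 1 hC ha hx'
    have h2 : |x - a| ≤ |a' - a| := abs_sub_left_of_mem_uIcc hx
    have hC0 : 0 ≤ C := (abs_nonneg _).trans (hC a ha)
    rw [one_mul, Real.norm_eq_abs]
    exact h1.trans (by gcongr)

/-- The integrand is the square of the reflected raw kernel at `t = 1`, so the square of the
majorant justifies differentiation under the integral sign. The term `1/(2H)` keeps the base of the
power `-1/2` positive. -/
theorem differentiableAt_normConst {H : ℝ} (hH : H ∈ Ioo (0 : ℝ) 1) :
    DifferentiableAt ℝ normConst H := by
  obtain ⟨h0, h1⟩ := hH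
  obtain ⟨d, hd, hd'⟩ : ∃ d, |H - 1 / 2| < d ∧ d < 1 / 2 :=
    exists_between (abs_lt.2 ⟨by linarith, by linarith⟩)
  have hd0 : 0 ≤ d := (abs_nonneg _).trans hd.le
  obtain ⟨G, g, -, hg, -, hgk⟩ := exists_rawKernel_majorant (T := 1) zero_le_one hd0 hd'
  have hS : {h : ℝ | |h - 1 / 2| < d} ∈ 𝓝 H :=
    (isOpen_lt (by fun_prop) (by fun_prop)).mem_nhds hd
  have h1m : (1 : ℝ) ∈ Icc (0 : ℝ) 1 := ⟨zero_le_one, le_rfl⟩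
  have hraw : ∀ h : ℝ, ∀ s ∈ Ioi (0 : ℝ),
      ((1 + s) ^ (h - 1 / 2) - s ^ (h - 1 / 2)) ^ 2 = rawKernel 0 (h - 1 / 2) 1 (-s) ^ 2 := by
    intro h s hs
    have hs0 : 0 < s := hs
    have hs1 : 0 < 1 + s := by linarith
    simp [rawKernel, posPowLog, hs0, hs1]
  have hI : ∀ h : ℝ, ∫ s in Ioi (0 : ℝ), ((1 + s) ^ (h - 1 / 2) - s ^ (h - 1 / 2)) ^ 2 =
      ∫ s in Ioi (0 : ℝ), rawKernel 0 (h - 1 / 2) 1 (-s) ^ 2 :=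
    fun h => setIntegral_congr_fun measurableSet_Ioi (hraw h)
  have hm : ∀ j a, Measurable fun s => rawKernel j a 1 (-s) := fun j a =>
    (measurable_rawKernel j a 1).comp measurable_neg
  have hgint : Integrable (fun s => g 1 (-s) ^ 2) (volume.restrict (Ioi (0 : ℝ))) :=
    (((hg 1).comp_measurePreserving (Measure.measurePreserving_neg volume)).integrable_sq).restrict
  have hdiff : DifferentiableAt ℝ
      (fun h : ℝ => ∫ s in Ioi (0 : ℝ), rawKernel 0 (h - 1 / 2) 1 (-s) ^ 2) H := by
    refine (hasDerivAt_integral_of_dominated_loc_of_deriv_le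
      (F := fun h s => rawKernel 0 (h - 1 / 2) 1 (-s) ^ 2)
      (F' := fun h s => 2 * rawKernel 0 (h - 1 / 2) 1 (-s) * rawKernel 1 (h - 1 / 2) 1 (-s))
      (bound := fun s => 2 * g 1 (-s) ^ 2) hS ?_ ?_ ?_ ?_ ?_ ?_).2.differentiableAt
    · exact Eventually.of_forall fun h => ((hm 0 _).pow_const 2).aestronglyMeasurable
    · refine hgint.mono' ((hm 0 _).pow_const 2).aestronglyMeasurable (ae_of_all _ fun s => ?_)
      rw [Real.norm_eq_abs, abs_pow]
      exact pow_le_pow_left₀ (abs_nonneg _) (hgk 1 h1m _ hd.le 0 (by norm_num) _) 2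
    · exact (((hm 0 _).const_mul 2).mul (hm 1 _)).aestronglyMeasurable
    · refine ae_of_all _ fun s h hh => ?_
      have e0 := hgk 1 h1m (h - 1 / 2) (le_of_lt hh) 0 (by norm_num) (-s)
      have e1 := hgk 1 h1m (h - 1 / 2) (le_of_lt hh) 1 (by norm_num) (-s)
      rw [Real.norm_eq_abs, abs_mul, abs_mul, abs_two, sq, mul_assoc]
      gcongr
      exact (abs_nonneg _).trans e0
    · exact hgint.const_mul 2
    · refine ae_of_all _ fun s h hh => ?_
      have e := ((hasDerivAt_rawKernel 0 (h - 1 / 2) 1 (-s)).comp_sub_const h (1 / 2)).pow 2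
      refine e.congr_deriv ?_
      simp
  unfold normConst
  simp_rw [hI]
  refine DifferentiableAt.rpow_const (hdiff.add ?_) (Or.inl ?_)
  · exact (differentiableAt_const _).div (by fun_prop) (by positivity)
  · have : 0 ≤ ∫ s in Ioi (0 : ℝ), rawKernel 0 (H - 1 / 2) 1 (-s) ^ 2 :=
      integral_nonneg fun s => sq_nonneg _
    positivity

theorem kernelDeriv_eq {H : ℝ} (hH : H ∈ Ioo (0 : ℝ) 1) (t s : ℝ) :
    kernelDeriv H t s = deriv normConst H * rawKernel 0 (H - 1 / 2) t s +
      normConst H * rawKernel 1 (H - 1 / 2) t s := by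
  unfold kernelDeriv
  simp_rw [kernel_eq]
  exact ((differentiableAt_normConst hH).hasDerivAt.mul
    ((hasDerivAt_rawKernel 0 (H - 1 / 2) t s).comp_sub_const H (1 / 2))).deriv

theorem kernel_zero (H s : ℝ) : kernel H 0 s = 0 := by
  simp [kernel]

theorem kernel_eq_zero_of_lt (H : ℝ) {t s : ℝ} (ht : 0 ≤ t) (h : t < s) : kernel H t s = 0 := by
  simp [kernel, posPow, not_lt.2 (sub_nonpos.2 h.le), not_lt.2 (neg_nonpos.2 (ht.trans h.le))]

theorem eLpNorm_le_of_abs_le {f g : ℝ → ℝ} {c G : ℝ} (hc : 0 ≤ c)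
    (hG : eLpNorm g 2 volume ≤ ENNReal.ofReal G) (h : ∀ s, |f s| ≤ c * g s) :
    eLpNorm f 2 volume ≤ ENNReal.ofReal (c * G) := by
  calc eLpNorm f 2 volume ≤ eLpNorm (c • g) 2 volume := by
        refine eLpNorm_mono fun s => ?_
        exact (h s).trans (le_abs_self _)
    _ = ENNReal.ofReal c * eLpNorm g 2 volume := by
        rw [eLpNorm_const_smul, Real.enorm_of_nonneg hc]
    _ ≤ ENNReal.ofReal c * ENNReal.ofReal G := by gcongr
    _ = _ := (ENNReal.ofReal_mul hc).symm

/-- The kernel is differentiable in the Hurst parameter, in `L²(ℝ)` and uniformly in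
`t ∈ [0,T]`. -/
theorem exists_kernel_bounds {T H : ℝ} (hT : 0 ≤ T) (hH : H ∈ Ioo (0 : ℝ) 1) :
    ∃ (C : ℝ) (r : ℝ → ℝ), 0 < C ∧ (∀ h, 0 ≤ r h) ∧ r =o[𝓝 H] (fun h => h - H) ∧
      (∀ t ∈ Icc 0 T, MemLp (kernelDeriv H t) 2 volume ∧
        eLpNorm (kernelDeriv H t) 2 volume ≤ ENNReal.ofReal C) ∧
      ∀ᶠ h in 𝓝 H, h ∈ Ioo (0 : ℝ) 1 ∧ ∀ t ∈ Icc 0 T,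
        eLpNorm (kernel h t) 2 volume ≤ ENNReal.ofReal C ∧
        eLpNorm (fun s => kernel h t s - kernel H t s) 2 volume ≤ ENNReal.ofReal (C * |h - H|) ∧
        eLpNorm (fun s => kernel h t s - kernel H t s - (h - H) * kernelDeriv H t s) 2 volume ≤
          ENNReal.ofReal (r h) := by
  obtain ⟨d, hd, hd'⟩ : ∃ d, |H - 1 / 2| < d ∧ d < 1 / 2 :=
    exists_between (abs_lt.2 ⟨by linarith [hH.1], by linarith [hH.2]⟩)
  have hd0 : 0 ≤ d := (abs_nonneg _).trans hd.le
  obtain ⟨G, g, hG0, hg, hG, hgk⟩ := exists_rawKernel_majorant hT hd0 hd'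
  have hdC := (differentiableAt_normConst hH).hasDerivAt
  set C' := deriv normConst H with hC'
  -- One constant dominates `normConst` at `H`, nearby values of `normConst`, and its derivative.
  -- The local Lipschitz constant `K + 1` below comes from the definition of the derivative with
  -- tolerance `1`.
  obtain ⟨K, hK0, hK, hK1, hK2⟩ : ∃ K : ℝ, 0 < K ∧ |normConst H| ≤ K ∧ |C'| ≤ K ∧
      ∀ᶠ h in 𝓝 H, |normConst h| < K := by
    refine ⟨|normConst H| + |C'| + 1, by positivity, by linarith [abs_nonneg C'],
      by linarith [abs_nonneg (normConst H)], ?_⟩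
    refine hdC.continuousAt.abs.eventually (gt_mem_nhds ?_)
    linarith [abs_nonneg C']
  have hS : ∀ᶠ h in 𝓝 H, |h - 1 / 2| < d :=
    (isOpen_lt (by fun_prop) (by fun_prop)).mem_nhds hd
  have hlip : ∀ᶠ h in 𝓝 H, |normConst h - normConst H| ≤ (K + 1) * |h - H| := by
    have := hdC.isLittleO.def one_pos
    filter_upwards [this] with h hh
    rw [Real.norm_eq_abs, Real.norm_eq_abs, one_mul] at hh
    have h1 := abs_sub_abs_le_abs_sub (normConst h - normConst H) ((h - H) • C')
    rw [smul_eq_mul] at h1 hh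
    rw [abs_mul] at h1
    nlinarith [abs_nonneg (h - H)]
  -- The terms are the Taylor remainder of the raw kernel, the first order remainder of `normConst`,
  -- and the product of the two increments; they come from the product-rule splitting of the kernel
  -- remainder.
  set r : ℝ → ℝ := fun h => (K * |h - H| ^ 2 + |normConst h - normConst H - (h - H) * C'| +
    (K + 1) * |h - H| ^ 2) * G with hr
  have hsq : (fun h : ℝ => |h - H| ^ 2) =o[𝓝 H] fun h => h - H := by
    have h1 : (fun h : ℝ => (h - H) ^ 2) =o[𝓝 H] fun h => h - H := by
      have := (Asymptotics.isLittleO_pow_id (𝕜 := ℝ) one_lt_two).comp_tendsto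
        (show Tendsto (fun h : ℝ => h - H) (𝓝 H) (𝓝 0) from by
          simpa using (continuous_sub_right H).tendsto H)
      exact this
    simpa only [sq_abs] using h1
  -- `3K + 1` covers the three factors that occur: `K` for the kernel, `2K` for its derivative and
  -- `K + (K + 1)` for its increment.
  refine ⟨(3 * K + 1) * G, r, by positivity, fun h => by positivity, ?_, ?_, ?_⟩
  · have h1 : (fun h : ℝ => |normConst h - normConst H - (h - H) * C'|) =o[𝓝 H]
        fun h => h - H := by
      have := hdC.isLittleO.norm_left
      simpa only [Real.norm_eq_abs, smul_eq_mul] using this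
    have h2 := ((hsq.const_mul_left K).add h1).add (hsq.const_mul_left (K + 1))
    simpa only [hr, mul_comm _ G] using h2.const_mul_left G
  · intro t ht
    have hb : ∀ s, |kernelDeriv H t s| ≤ (3 * K + 1) * g t s := by
      intro s
      have e0 := hgk t ht _ hd.le 0 (by norm_num) s
      have e1 := hgk t ht _ hd.le 1 (by norm_num) s
      have hgs : 0 ≤ g t s := (abs_nonneg _).trans e0
      rw [kernelDeriv_eq hH]
      calc _ ≤ |C'| * |rawKernel 0 (H - 1 / 2) t s| +
            |normConst H| * |rawKernel 1 (H - 1 / 2) t s| := by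
            rw [← abs_mul, ← abs_mul]
            exact abs_add_le _ _
        _ ≤ K * g t s + K * g t s := by gcongr
        _ ≤ _ := by nlinarith
    refine ⟨?_, eLpNorm_le_of_abs_le (by positivity) (hG t) hb⟩
    have hmeas : Measurable (kernelDeriv H t) := by
      rw [show kernelDeriv H t = _ from funext (kernelDeriv_eq hH t)]
      exact ((measurable_rawKernel 0 _ t).const_mul _).add ((measurable_rawKernel 1 _ t).const_mul _)
    exact ((hg t).const_mul (3 * K + 1)).mono hmeas.aestronglyMeasurable
      (ae_of_all _ fun s => (hb s).trans (le_abs_self _))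
  · filter_upwards [hS, hK2, hlip, Ioo_mem_nhds hH.1 hH.2] with h h1 h2 h3 h4
    refine ⟨h4, fun t ht => ?_⟩
    have hshift : h - 1 / 2 - (H - 1 / 2) = h - H := by ring
    have e0 : ∀ s, |rawKernel 0 (H - 1 / 2) t s| ≤ g t s := hgk t ht _ hd.le 0 (by norm_num)
    have e1 : ∀ s, |rawKernel 1 (H - 1 / 2) t s| ≤ g t s := hgk t ht _ hd.le 1 (by norm_num)
    have e0' : ∀ s, |rawKernel 0 (h - 1 / 2) t s| ≤ g t s := hgk t ht _ h1.le 0 (by norm_num)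
    have hgs : ∀ s, 0 ≤ g t s := fun s => (abs_nonneg _).trans (e0 s)
    have hl : ∀ s, |rawKernel 0 (h - 1 / 2) t s - rawKernel 0 (H - 1 / 2) t s| ≤
        g t s * |h - H| := fun s => hshift ▸ abs_rawKernel_sub_le 0
          (fun a ha => hgk t ht a ha 1 (by norm_num) s) hd.le h1.le
    have ht2 : ∀ s, |rawKernel 0 (h - 1 / 2) t s - rawKernel 0 (H - 1 / 2) t s -
        (h - H) * rawKernel 1 (H - 1 / 2) t s| ≤ g t s * |h - H| ^ 2 := fun s =>
      hshift ▸ abs_rawKernel_taylor_le (fun a ha => hgk t ht a ha 2 le_rfl s) hd.le h1.le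
    refine ⟨eLpNorm_le_of_abs_le (by positivity) (hG t) fun s => ?_, ?_, ?_⟩
    · rw [kernel_eq, abs_mul]
      calc _ ≤ K * g t s := by gcongr; exact e0' s
        _ ≤ _ := by nlinarith [hgs s]
    · rw [mul_right_comm]
      refine eLpNorm_le_of_abs_le (by positivity) (hG t) fun s => ?_
      have : kernel h t s - kernel H t s =
          normConst h * (rawKernel 0 (h - 1 / 2) t s - rawKernel 0 (H - 1 / 2) t s) +
          (normConst h - normConst H) * rawKernel 0 (H - 1 / 2) t s := by
        rw [kernel_eq, kernel_eq]; ring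
      rw [this]
      calc _ ≤ |normConst h| * |rawKernel 0 (h - 1 / 2) t s - rawKernel 0 (H - 1 / 2) t s| +
            |normConst h - normConst H| * |rawKernel 0 (H - 1 / 2) t s| := by
            rw [← abs_mul, ← abs_mul]
            exact abs_add_le _ _
        _ ≤ K * (g t s * |h - H|) + (K + 1) * |h - H| * g t s := by
            gcongr
            · exact hl s
            · exact e0 s
        _ ≤ _ := by
            have := mul_nonneg (mul_nonneg hK0.le (hgs s)) (abs_nonneg (h - H))
            linarith
    · refine eLpNorm_le_of_abs_le (by positivity) (hG t) fun s => ?_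
      have : kernel h t s - kernel H t s - (h - H) * kernelDeriv H t s =
          normConst h * (rawKernel 0 (h - 1 / 2) t s - rawKernel 0 (H - 1 / 2) t s -
            (h - H) * rawKernel 1 (H - 1 / 2) t s) +
          (normConst h - normConst H - (h - H) * C') * rawKernel 0 (H - 1 / 2) t s +
          (normConst h - normConst H) * ((h - H) * rawKernel 1 (H - 1 / 2) t s) := by
        rw [kernel_eq, kernel_eq, kernelDeriv_eq hH]; ring
      rw [this]
      calc _ ≤ |normConst h| * |rawKernel 0 (h - 1 / 2) t s - rawKernel 0 (H - 1 / 2) t s -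
              (h - H) * rawKernel 1 (H - 1 / 2) t s| +
            |normConst h - normConst H - (h - H) * C'| * |rawKernel 0 (H - 1 / 2) t s| +
            |normConst h - normConst H| * (|h - H| * |rawKernel 1 (H - 1 / 2) t s|) := by
            simp only [← abs_mul]
            exact abs_add_three _ _ _
        _ ≤ K * (g t s * |h - H| ^ 2) +
            |normConst h - normConst H - (h - H) * C'| * g t s +
            (K + 1) * |h - H| * (|h - H| * g t s) := by
            gcongr
            · exact ht2 s
            · exact e0 s
            · exact e1 s
        _ = _ := by ring

end KernelBounds

section Pathwise

variable {Ω : Type*} {T : ℝ}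

/-! ### Integrals over `[0,T]` -/

/-- Moving the variable endpoint into the integrand gives an integral over a fixed space, for which
joint measurability and Fubini arguments are available. -/
theorem intervalIntegral_eq_timeMeasure {t : ℝ} (ht : t ∈ Icc 0 T) (f : ℝ → ℝ) :
    ∫ u in (0 : ℝ)..t, f u = ∫ u : Icc (0 : ℝ) T, (if (u : ℝ) ≤ t then f u else 0) ∂timeMeasure T := by
  rw [timeMeasure, integral_subtype_comap measurableSet_Icc
    (fun u : ℝ => if u ≤ t then f u else 0), intervalIntegral.integral_of_le ht.1,
    ← integral_Icc_eq_integral_Ioc]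
  have : (fun u : ℝ => if u ≤ t then f u else 0) = (Iic t).indicator f := by
    ext u
    simp [indicator_apply]
  rw [this, setIntegral_indicator measurableSet_Iic]
  congr 2
  ext u
  simp only [mem_Icc, mem_inter_iff, mem_Iic]
  exact ⟨fun h => ⟨⟨h.1, h.2.trans ht.2⟩, h.2⟩, fun h => ⟨h.1.1, h.2⟩⟩

theorem timeMeasure_univ (T : ℝ) : timeMeasure T univ = ENNReal.ofReal T := by
  rw [timeMeasure, (MeasurableEmbedding.subtype_coe measurableSet_Icc).comap_apply]
  simp [Subtype.range_coe_subtype]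
  rw [show {x : ℝ | 0 ≤ x ∧ x ≤ T} = Icc 0 T from rfl, Real.volume_Icc, sub_zero]

theorem intervalIntegrable_iff_timeMeasure (hT : 0 ≤ T) {f : ℝ → ℝ} :
    IntervalIntegrable f volume 0 T ↔ Integrable (fun u : Icc (0 : ℝ) T => f u) (timeMeasure T) := by
  rw [intervalIntegrable_iff_integrableOn_Icc_of_le hT, timeMeasure]
  exact integrableOn_iff_comap_subtypeVal measurableSet_Icc

/-- Uses `e^{-αt} ≤ 1` and `e^{αu} ≤ e^{αT}`. With values in `ℝ≥0∞` the bound needs no integrability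
of the path. -/
theorem enorm_dLambda_le {α : ℝ} (hα : 0 < α) (A : ℝ → Ω → ℝ) {t : ℝ} (ht : t ∈ Icc 0 T)
    (ω : Ω) : ‖dLambda α A t ω‖ₑ ≤ ‖A t ω‖ₑ +
      ENNReal.ofReal (α * Real.exp (α * T)) * ∫⁻ u : Icc (0 : ℝ) T, ‖A u ω‖ₑ ∂timeMeasure T := by
  unfold dLambda
  refine (enorm_sub_le).trans (add_le_add le_rfl ?_)
  rw [enorm_mul, intervalIntegral_eq_timeMeasure ht]
  have h1 : ‖α * Real.exp (-α * t)‖ₑ ≤ ENNReal.ofReal α := by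
    rw [Real.enorm_of_nonneg (by positivity)]
    refine ENNReal.ofReal_le_ofReal (mul_le_of_le_one_right hα.le (Real.exp_le_one_iff.2 ?_))
    nlinarith [ht.1]
  have h2 : ‖∫ u : Icc (0 : ℝ) T, (if (u : ℝ) ≤ t then A u ω * Real.exp (α * u) else 0)
      ∂timeMeasure T‖ₑ ≤
      ENNReal.ofReal (Real.exp (α * T)) * ∫⁻ u : Icc (0 : ℝ) T, ‖A u ω‖ₑ ∂timeMeasure T := by
    refine (enorm_integral_le_lintegral_enorm _).trans ?_
    rw [← lintegral_const_mul' _ _ ENNReal.ofReal_ne_top]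
    refine lintegral_mono fun u => ?_
    split_ifs
    · rw [enorm_mul, mul_comm, Real.enorm_of_nonneg (Real.exp_pos _).le]
      gcongr
      exact u.2.2
    · simp
  rw [ENNReal.ofReal_mul hα.le, mul_assoc]
  exact mul_le_mul' h1 h2

/-- Integrability of the paths is essential, since a non-integrable path would contribute the
default value `0`. The case `ε = 0` serves for plain differences. -/
theorem dLambda_linear {α ε : ℝ} {X Y A : ℝ → Ω → ℝ} {ω : Ω} (hT : 0 ≤ T)
    (hX : IntervalIntegrable (fun u => X u ω) volume 0 T)
    (hY : IntervalIntegrable (fun u => Y u ω) volume 0 T)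
    (hA : IntervalIntegrable (fun u => A u ω) volume 0 T) {t : ℝ} (ht : t ∈ Icc 0 T) :
    dLambda α (fun u ω => X u ω - Y u ω - ε * A u ω) t ω =
      dLambda α X t ω - dLambda α Y t ω - ε * dLambda α A t ω := by
  have hint : ∀ {Z : ℝ → Ω → ℝ}, IntervalIntegrable (fun u => Z u ω) volume 0 T →
      IntervalIntegrable (fun u => Z u ω * Real.exp (α * u)) volume 0 t := by
    intro Z hZ
    have h1 : IntervalIntegrable (fun u => Z u ω) volume 0 t := hZ.mono_set (by
      rw [uIcc_of_le ht.1, uIcc_of_le hT]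
      exact Icc_subset_Icc_right ht.2)
    exact h1.mul_continuousOn (by fun_prop)
  unfold dLambda
  have e : (∫ u in (0 : ℝ)..t, (X u ω - Y u ω - ε * A u ω) * Real.exp (α * u)) =
      (∫ u in (0 : ℝ)..t, X u ω * Real.exp (α * u)) -
        (∫ u in (0 : ℝ)..t, Y u ω * Real.exp (α * u)) -
        ε * ∫ u in (0 : ℝ)..t, A u ω * Real.exp (α * u) := by
    rw [← intervalIntegral.integral_const_mul,
      ← intervalIntegral.integral_sub (hint hX) (hint hY),
      ← intervalIntegral.integral_sub ((hint hX).sub (hint hY)) ((hint hA).const_mul ε)]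
    refine intervalIntegral.integral_congr fun u _ => ?_
    ring
  rw [e]
  ring

/-- The explicit form of the Ornstein-Uhlenbeck process. -/
theorem IsOrnsteinUhlenbeck.eq_dLambda {α : ℝ} {y₀ : Ω → ℝ} {X Y : ℝ → Ω → ℝ} (hT : 0 ≤ T)
    (h : IsOrnsteinUhlenbeck T α y₀ X Y) {ω : Ω} (hX : ContinuousOn (fun t => X t ω) (Ici 0))
    {t : ℝ} (ht : t ∈ Icc 0 T) :
    Y t ω = Real.exp (-α * t) * y₀ ω + dLambda α (fun t ω => X t ω - X 0 ω) t ω := by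
  -- Extending the paths continuously to the whole line makes the fundamental theorem of calculus
  -- available at every point, endpoints included.
  obtain ⟨y, hy, hyY⟩ : ∃ y : ℝ → ℝ, Continuous y ∧ ∀ u ∈ Icc 0 T, y u = Y u ω :=
    ⟨IccExtend hT (fun u => Y u ω), (continuousOn_iff_continuous_domRestrict.1 (h.continuous ω)).Icc_extend',
      fun u hu => IccExtend_of_mem hT _ hu⟩
  obtain ⟨x, hx, hxX⟩ : ∃ x : ℝ → ℝ, Continuous x ∧ ∀ u ∈ Icc 0 T, x u = X u ω - X 0 ω :=
    ⟨IccExtend hT (fun u => X u ω - X 0 ω), (continuousOn_iff_continuous_domRestrict.1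
      ((hX.mono Icc_subset_Ici_self).sub continuousOn_const)).Icc_extend',
      fun u hu => IccExtend_of_mem hT _ hu⟩
  have hcongr : ∀ {f g : ℝ → ℝ} {s : ℝ}, s ∈ Icc 0 T → (∀ u ∈ Icc 0 T, f u = g u) →
      ∫ u in (0 : ℝ)..s, f u = ∫ u in (0 : ℝ)..s, g u := by
    intro f g s hs hfg
    refine intervalIntegral.integral_congr fun u hu => hfg u ?_
    rw [uIcc_of_le hs.1] at hu
    exact ⟨hu.1, hu.2.trans hs.2⟩
  have hyeq : ∀ s ∈ Icc 0 T, y s = y₀ ω + (∫ u in (0 : ℝ)..s, -α * y u) + x s := by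
    intro s hs
    rw [hyY s hs, h.eq ω s hs, hxX s hs]
    congr 2
    exact hcongr hs fun u hu => by rw [hyY u hu]
  have hD : ∀ s, HasDerivAt (fun s => y₀ ω + ∫ u in (0 : ℝ)..s, -α * y u) (-α * y s) s := fun s =>
    (intervalIntegral.integral_hasDerivAt_right ((hy.const_mul _).intervalIntegrable _ _)
      ((hy.const_mul _).stronglyMeasurableAtFilter _ _) (hy.const_mul _).continuousAt).const_add _
  have hxe : Continuous fun u => x u * Real.exp (α * u) := by fun_prop
  have hE : ∀ s, HasDerivAt (fun s => ∫ u in (0 : ℝ)..s, x u * Real.exp (α * u))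
      (x s * Real.exp (α * s)) s := fun s =>
    intervalIntegral.integral_hasDerivAt_right (hxe.intervalIntegrable _ _)
      (hxe.stronglyMeasurableAtFilter _ _) hxe.continuousAt
  have hexp : ∀ s, HasDerivAt (fun s => Real.exp (α * s)) (Real.exp (α * s) * (α * 1)) s :=
    fun s => ((hasDerivAt_id s).const_mul α).exp
  -- Integrating factor: by the integral equation for `y`, the derivative of this function vanishes
  -- on `[0,T)`, so the function stays equal to `y₀`.
  have hF : ∀ s, HasDerivAt (fun s => Real.exp (α * s) * (y₀ ω + ∫ u in (0 : ℝ)..s, -α * y u) +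
      α * ∫ u in (0 : ℝ)..s, x u * Real.exp (α * u)) _ s := fun s =>
    ((hexp s).mul (hD s)).add ((hE s).const_mul α)
  have hconst := constant_of_has_deriv_right_zero (a := 0) (b := T)
    (fun s _ => (hF s).continuousAt.continuousWithinAt) (fun s hs => by
      refine ((hF s).congr_deriv ?_).hasDerivWithinAt
      have := hyeq s ⟨hs.1, hs.2.le⟩
      set J := ∫ u in (0 : ℝ)..s, -α * y u
      rw [this]
      ring) t ht
  simp only [intervalIntegral.integral_same, mul_zero, add_zero, Real.exp_zero, one_mul] at hconst
  have hfin := hyeq t ht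
  have he : Real.exp (-α * t) * Real.exp (α * t) = 1 := by
    rw [← Real.exp_add]
    simp
  have hint : (∫ u in (0 : ℝ)..t, x u * Real.exp (α * u)) =
      ∫ u in (0 : ℝ)..t, (X u ω - X 0 ω) * Real.exp (α * u) :=
    hcongr ht fun u hu => by rw [hxX u hu]
  simp only [dLambda]
  rw [← hint, ← hxX t ht, ← hyY t ht, hfin]
  linear_combination Real.exp (-α * t) * hconst -
    (y₀ ω + ∫ u in (0 : ℝ)..t, -α * y u) * he

end Pathwise

section Moments

variable {Ω : Type*} [mΩ : MeasurableSpace Ω] {μ : Measure Ω} {T : ℝ}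

/-! ### Moments -/

theorem lintegral_rpow_le_rpow_univ {α : Type*} [MeasurableSpace α] (ν : Measure α)
    {p : ℝ} (hp : 1 ≤ p) {f : α → ℝ≥0∞} (hf : AEMeasurable f ν) :
    (∫⁻ x, f x ∂ν) ^ p ≤ ν univ ^ (p - 1) * ∫⁻ x, f x ^ p ∂ν := by
  have hp0 : 0 < p := by linarith
  have h := eLpNorm'_le_eLpNorm'_mul_rpow_measure_univ one_pos hp hf.aestronglyMeasurable
  simp only [eLpNorm', enorm_eq_self, ENNReal.rpow_one, one_div, inv_one] at h
  calc (∫⁻ x, f x ∂ν) ^ p ≤ ((∫⁻ x, f x ^ p ∂ν) ^ p⁻¹ * ν univ ^ (1 - p⁻¹)) ^ p := by gcongr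
    _ = _ := by
      rw [ENNReal.mul_rpow_of_nonneg _ _ hp0.le, ← ENNReal.rpow_mul, ← ENNReal.rpow_mul,
        inv_mul_cancel₀ hp0.ne', ENNReal.rpow_one, mul_comm]
      congr 2
      field_simp

/-- A bound on the `2β`-moments of a process, uniform in time, bounds its norm in `D_β`. -/
theorem processENorm_le [SFinite μ] {β : ℝ} (hβ : 1 < β) {X : Icc (0 : ℝ) T → Ω → ℝ}
    (hX : Measurable fun p : Ω × Icc (0 : ℝ) T => X p.2 p.1) {m : ℝ≥0∞}
    (h : ∀ t, ∫⁻ ω, ‖X t ω‖ₑ ^ (2 * β) ∂μ ≤ m) :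
    processENorm μ β X ≤ (ENNReal.ofReal T ^ β * m) ^ (1 / (2 * β)) := by
  have h0 : (0 : ℝ) < β := by linarith
  unfold processENorm
  refine ENNReal.rpow_le_rpow ?_ (by positivity)
  calc ∫⁻ ω, (∫⁻ t : Icc (0 : ℝ) T, ‖X t ω‖ₑ ^ (2 : ℝ) ∂timeMeasure T) ^ β ∂μ
      ≤ ∫⁻ ω, timeMeasure T univ ^ (β - 1) *
          ∫⁻ t : Icc (0 : ℝ) T, ‖X t ω‖ₑ ^ (2 * β) ∂timeMeasure T ∂μ := by
        refine lintegral_mono fun ω => ?_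
        refine (lintegral_rpow_le_rpow_univ _ hβ.le
          ((hX.comp (measurable_prodMk_left (x := ω))).enorm.pow_const 2).aemeasurable).trans_eq ?_
        congr 2
        ext t
        rw [ENNReal.rpow_mul]
        rfl
    _ = timeMeasure T univ ^ (β - 1) *
          ∫⁻ t : Icc (0 : ℝ) T, ∫⁻ ω, ‖X t ω‖ₑ ^ (2 * β) ∂μ ∂timeMeasure T := by
        rw [lintegral_const_mul' _ _ (ENNReal.rpow_ne_top_of_nonneg (by linarith)
          (measure_ne_top _ _)), lintegral_lintegral_swap]
        exact (hX.enorm.pow_const (2 * β)).aemeasurable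
    _ ≤ timeMeasure T univ ^ (β - 1) * ∫⁻ _ : Icc (0 : ℝ) T, m ∂timeMeasure T := by
        gcongr with t
        exact h t
    _ = _ := by
        rw [lintegral_const, timeMeasure_univ, mul_comm m, ← mul_assoc]
        congr 1
        -- No sign of `T` is assumed here, and the exponents `β - 1` and `1` add up only for a
        -- nonzero base.
        rcases eq_or_ne (ENNReal.ofReal T) 0 with hz | hz
        · rw [hz, mul_zero, ENNReal.zero_rpow_of_pos h0]
        · nth_rw 2 [← ENNReal.rpow_one (ENNReal.ofReal T)]
          rw [← ENNReal.rpow_add _ _ hz ENNReal.ofReal_ne_top]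
          congr 1
          ring

/-- The constant in the moment estimate for `dLambda`. -/
def dLambdaConst (T α p : ℝ) : ℝ≥0∞ :=
  2 ^ (p - 1) * (1 + ENNReal.ofReal (α * Real.exp (α * T)) ^ p * (ENNReal.ofReal T ^ (p - 1) *
    ENNReal.ofReal T))

theorem dLambdaConst_ne_top (T α : ℝ) {p : ℝ} (hp : 1 ≤ p) : dLambdaConst T α p ≠ ∞ := by
  have h1 : ∀ x : ℝ≥0∞, x ≠ ∞ → x ^ (p - 1) ≠ ∞ := fun x hx =>
    ENNReal.rpow_ne_top_of_nonneg (by linarith) hx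
  have h2 : ∀ x : ℝ≥0∞, x ≠ ∞ → x ^ p ≠ ∞ := fun x hx =>
    ENNReal.rpow_ne_top_of_nonneg (by linarith) hx
  exact ENNReal.mul_ne_top (h1 _ (by simp)) (ENNReal.add_ne_top.2 ⟨by simp,
    ENNReal.mul_ne_top (h2 _ (by simp)) (ENNReal.mul_ne_top (h1 _ (by simp)) (by simp))⟩)

theorem lintegral_rpow_lintegral_le [SFinite μ] {A : ℝ → Ω → ℝ} {p : ℝ} (hp : 1 ≤ p)
    (hA : Measurable fun q : Ω × Icc (0 : ℝ) T => A q.2 q.1) {m : ℝ≥0∞}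
    (h : ∀ t ∈ Icc 0 T, ∫⁻ ω, ‖A t ω‖ₑ ^ p ∂μ ≤ m) :
    ∫⁻ ω, (∫⁻ u : Icc (0 : ℝ) T, ‖A u ω‖ₑ ∂timeMeasure T) ^ p ∂μ ≤
      ENNReal.ofReal T ^ (p - 1) * ENNReal.ofReal T * m := by
  calc _ ≤ ∫⁻ ω, timeMeasure T univ ^ (p - 1) *
          ∫⁻ u : Icc (0 : ℝ) T, ‖A u ω‖ₑ ^ p ∂timeMeasure T ∂μ := by
        refine lintegral_mono fun ω => ?_
        exact lintegral_rpow_le_rpow_univ _ hp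
          (hA.comp (measurable_prodMk_left (x := ω))).enorm.aemeasurable
    _ = timeMeasure T univ ^ (p - 1) *
          ∫⁻ u : Icc (0 : ℝ) T, ∫⁻ ω, ‖A u ω‖ₑ ^ p ∂μ ∂timeMeasure T := by
        rw [lintegral_const_mul' _ _ (ENNReal.rpow_ne_top_of_nonneg (by linarith)
          (measure_ne_top _ _)), lintegral_lintegral_swap]
        exact (hA.enorm.pow_const p).aemeasurable
    _ ≤ timeMeasure T univ ^ (p - 1) * ∫⁻ _ : Icc (0 : ℝ) T, m ∂timeMeasure T := by
        gcongr with u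
        exact h u u.2
    _ = _ := by
        rw [lintegral_const, timeMeasure_univ, mul_comm m, ← mul_assoc]

theorem lintegral_dLambda_rpow_le [SFinite μ] {α : ℝ} (hα : 0 < α) {A : ℝ → Ω → ℝ} {p : ℝ}
    (hp : 1 ≤ p) (hA : Measurable fun q : Ω × Icc (0 : ℝ) T => A q.2 q.1) {m : ℝ≥0∞}
    (h : ∀ t ∈ Icc 0 T, ∫⁻ ω, ‖A t ω‖ₑ ^ p ∂μ ≤ m) {t : ℝ} (ht : t ∈ Icc 0 T) :
    ∫⁻ ω, ‖dLambda α A t ω‖ₑ ^ p ∂μ ≤ dLambdaConst T α p * m := by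
  have hp0 : 0 ≤ p := by linarith
  set k := ENNReal.ofReal (α * Real.exp (α * T)) with hk
  have hAt : Measurable (A t) := hA.comp (measurable_prodMk_right (y := (⟨t, ht⟩ : Icc (0 : ℝ) T)))
  calc ∫⁻ ω, ‖dLambda α A t ω‖ₑ ^ p ∂μ
      ≤ ∫⁻ ω, 2 ^ (p - 1) * (‖A t ω‖ₑ ^ p +
          k ^ p * (∫⁻ u : Icc (0 : ℝ) T, ‖A u ω‖ₑ ∂timeMeasure T) ^ p) ∂μ := by
        refine lintegral_mono fun ω => ?_
        rw [← ENNReal.mul_rpow_of_nonneg _ _ hp0]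
        exact (ENNReal.rpow_le_rpow (enorm_dLambda_le hα A ht ω) hp0).trans
          (ENNReal.rpow_add_le_mul_rpow_add_rpow _ _ hp)
    _ = 2 ^ (p - 1) * (∫⁻ ω, ‖A t ω‖ₑ ^ p ∂μ +
          k ^ p * ∫⁻ ω, (∫⁻ u : Icc (0 : ℝ) T, ‖A u ω‖ₑ ∂timeMeasure T) ^ p ∂μ) := by
        rw [lintegral_const_mul' _ _ (ENNReal.rpow_ne_top_of_nonneg (by linarith) (by simp)),
          lintegral_add_left (hAt.enorm.pow_const p), lintegral_const_mul' _ _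
          (ENNReal.rpow_ne_top_of_nonneg hp0 (by simp [hk]))]
    _ ≤ 2 ^ (p - 1) * (m + k ^ p * (ENNReal.ofReal T ^ (p - 1) * ENNReal.ofReal T * m)) := by
        gcongr
        · exact h t ht
        · exact lintegral_rpow_lintegral_le hp hA h
    _ = _ := by
        rw [dLambdaConst]
        ring

end Moments

/-! ### Progressive measurability -/

section Progressive

variable {Ω : Type*} {T : ℝ}

/-- The σ-algebra on `Ω` is left free so that it can be taken to be `F i` at a fixed time. -/
theorem stronglyMeasurable_integral_le [MeasurableSpace Ω] {S : Type*} [MeasurableSpace S]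
    {τ : S → ℝ} (hτ : Measurable τ) {f : Icc (0 : ℝ) T × Ω → ℝ} (hf : StronglyMeasurable f) :
    StronglyMeasurable fun p : S × Ω =>
      ∫ u : Icc (0 : ℝ) T, (if (u : ℝ) ≤ τ p.1 then f (u, p.2) else 0) ∂timeMeasure T := by
  refine StronglyMeasurable.integral_prod_right'
    (f := fun q : (S × Ω) × Icc (0 : ℝ) T => if (q.2 : ℝ) ≤ τ q.1.1 then f (q.2, q.1.2) else 0) ?_
  refine StronglyMeasurable.ite ?_ ?_ stronglyMeasurable_const
  · exact measurableSet_le (measurable_subtype_coe.comp measurable_snd)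
      (hτ.comp (measurable_fst.comp measurable_fst))
  · exact hf.comp_measurable (measurable_snd.prodMk (measurable_snd.comp measurable_fst))

variable [mΩ : MeasurableSpace Ω] {F : Filtration (Icc (0 : ℝ) T) mΩ}

/-- Replacing `A_u` by `A_{min u i}` gives an integrand on all of `[0,T]` that is measurable with
respect to `F i`. For `t ≤ i` the integral up to `t` sees only `u ≤ i`, where nothing has changed.
-/
theorem isStronglyProgressive_dLambda {α : ℝ} {A : ℝ → Ω → ℝ}
    (hA : IsStronglyProgressive F (fun t : Icc (0 : ℝ) T => A t)) :
    IsStronglyProgressive F (fun t : Icc (0 : ℝ) T => dLambda α A t) := by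
  intro i
  have hmin : Measurable fun u : Icc (0 : ℝ) T => (⟨min u i, mem_Iic.2 (min_le_right u i)⟩ : Iic i) :=
    Measurable.subtype_mk (measurable_id.min measurable_const)
  have h1 : StronglyMeasurable[Subtype.instMeasurableSpace.prod (F i)]
      fun q : Icc (0 : ℝ) T × Ω => A (min q.1 i : Icc (0 : ℝ) T) q.2 * Real.exp (α * q.1) := by
    refine StronglyMeasurable.mul ?_ ?_
    · exact (hA i).comp_measurable ((hmin.comp measurable_fst).prodMk measurable_snd)
    · refine Measurable.stronglyMeasurable ?_
      exact Real.measurable_exp.comp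
        ((measurable_subtype_coe.comp measurable_fst).const_mul α)
  have hτ : Measurable fun u : Iic i => ((u : Icc (0 : ℝ) T) : ℝ) :=
    measurable_subtype_coe.comp measurable_subtype_coe
  have h2 := @stronglyMeasurable_integral_le Ω T (F i) (Iic i) _ _ hτ _ h1
  have h3 : (fun p : Iic i × Ω => dLambda α A (p.1 : Icc (0 : ℝ) T) p.2) = fun p =>
      A (p.1 : Icc (0 : ℝ) T) p.2 - α * Real.exp (-α * ((p.1 : Icc (0 : ℝ) T) : ℝ)) *
        ∫ u : Icc (0 : ℝ) T, (if (u : ℝ) ≤ ((p.1 : Icc (0 : ℝ) T) : ℝ) then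
          A (min u i : Icc (0 : ℝ) T) p.2 * Real.exp (α * u) else 0) ∂timeMeasure T := by
    ext p
    rw [dLambda, intervalIntegral_eq_timeMeasure (p.1 : Icc (0 : ℝ) T).2]
    congr 2
    refine integral_congr_ae (ae_of_all _ fun u => ?_)
    simp only
    split_ifs with h
    · have : min u i = u := min_eq_left (le_trans (show u ≤ p.1 from h) p.1.2)
      rw [this]
    · rfl
  change StronglyMeasurable[Subtype.instMeasurableSpace.prod (F i)]
    fun p : Iic i × Ω => dLambda α A (p.1 : Icc (0 : ℝ) T) p.2
  rw [h3]
  refine StronglyMeasurable.sub (hA i) (StronglyMeasurable.mul ?_ h2)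
  refine Measurable.stronglyMeasurable ?_
  exact (Real.measurable_exp.comp ((hτ.comp measurable_fst).const_mul (-α))).const_mul α

theorem isStronglyProgressive_comp {X : Icc (0 : ℝ) T → Ω → ℝ} (hX : IsStronglyProgressive F X)
    {φ : ℝ → ℝ} (hφ : Continuous φ) : IsStronglyProgressive F (fun t ω => φ (X t ω)) :=
  fun i => hφ.comp_stronglyMeasurable (hX i)

theorem isStronglyProgressive_time_mul (hT : 0 ≤ T) {φ : ℝ → ℝ} (hφ : Continuous φ) {y : Ω → ℝ}
    (hy : Measurable[F ⟨0, le_rfl, hT⟩] y) :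
    IsStronglyProgressive F (fun (t : Icc (0 : ℝ) T) ω => φ t * y ω) := by
  refine StronglyAdapted.isStronglyProgressive_of_continuous (fun t => ?_) fun ω => ?_
  · refine Measurable.stronglyMeasurable ?_
    exact (hy.mono (F.mono t.2.1) le_rfl).const_mul _
  · exact (hφ.comp continuous_subtype_val).mul continuous_const

end Progressive

/-! ### Hölder and exponential moments -/

section Moments

variable {Ω : Type*} [mΩ : MeasurableSpace Ω] {μ : Measure Ω} {T : ℝ}

theorem lintegral_mul_rpow_le {f g : Ω → ℝ≥0∞} (hf : AEMeasurable f μ) (hg : AEMeasurable g μ)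
    {p : ℝ} (hp : 0 ≤ p) : ∫⁻ ω, (f ω * g ω) ^ p ∂μ ≤
      (∫⁻ ω, f ω ^ (2 * p) ∂μ) ^ (1 / 2 : ℝ) * (∫⁻ ω, g ω ^ (2 * p) ∂μ) ^ (1 / 2 : ℝ) := by
  have h := ENNReal.lintegral_mul_le_Lp_mul_Lq μ Real.HolderConjugate.two_two
    (hf.pow_const p) (hg.pow_const p)
  simp only [Pi.mul_apply, ← ENNReal.rpow_mul, mul_comm p 2] at h
  simp_rw [ENNReal.mul_rpow_of_nonneg _ _ hp]
  exact h

/-- Jensen's inequality for the exponential of a time integral. -/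
theorem exp_integral_le (hT : 0 < T) {f : Icc (0 : ℝ) T → ℝ} (hf : Continuous f) :
    ENNReal.ofReal (Real.exp (∫ u, f u ∂timeMeasure T)) ≤
      ENNReal.ofReal T⁻¹ * ∫⁻ u, ENNReal.ofReal (Real.exp (T * f u)) ∂timeMeasure T := by
  have hu : (timeMeasure T).real univ = T := by
    rw [measureReal_def, timeMeasure_univ, ENNReal.toReal_ofReal hT.le]
  have : NeZero (timeMeasure T) := ⟨fun h => by
    rw [h] at hu
    simp at hu
    exact hT.ne hu⟩
  have hint : ∀ {g : Icc (0 : ℝ) T → ℝ}, Continuous g → Integrable g (timeMeasure T) := by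
    intro g hg
    obtain ⟨C, hC⟩ := isCompact_univ.exists_bound_of_continuousOn hg.continuousOn
    exact Integrable.of_bound hg.aestronglyMeasurable C (ae_of_all _ fun u => hC u (mem_univ u))
  have hexp : Continuous fun u => Real.exp (T * f u) := by fun_prop
  -- The integral of `f` is the average of `T * f`, which is where the factor `T` in the exponent
  -- comes from.
  have h := convexOn_exp.map_average_le (μ := timeMeasure T) (f := fun u => T * f u)
    Real.continuous_exp.continuousOn isClosed_univ (ae_of_all _ fun _ => mem_univ _)
    (hint (by fun_prop)) (hint hexp)
  rw [average_eq, average_eq, hu, integral_const_mul, smul_eq_mul, smul_eq_mul,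
    inv_mul_cancel_left₀ hT.ne'] at h
  rw [← ofReal_integral_eq_lintegral_ofReal (hint hexp) (ae_of_all _ fun _ => (Real.exp_pos _).le),
    ← ENNReal.ofReal_mul (by positivity)]
  exact ENNReal.ofReal_le_ofReal h

/-- Exponential moments of `e^{-αt} y + X_t - α e^{-αt} ∫₀ᵗ X_u e^{αu} du`. -/
theorem lintegral_exp_dLambda_le [IsProbabilityMeasure μ] {α c : ℝ} (hT : 0 < T) (hα : 0 < α)
    (hc : 0 < c) {y : Ω → ℝ} (hy : Measurable y) {X : ℝ → Ω → ℝ}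
    (hXm : Measurable fun q : Ω × Icc (0 : ℝ) T => X q.2 q.1)
    (hXc : ∀ ω, ContinuousOn (fun t => X t ω) (Icc 0 T)) {Φ : ℝ → ℝ≥0∞}
    (hΦ : ∀ t ∈ Icc 0 T, ∀ c, ∫⁻ ω, ENNReal.ofReal (Real.exp (c * |X t ω|)) ∂μ ≤ Φ c)
    {t : ℝ} (ht : t ∈ Icc 0 T) :
    ∫⁻ ω, ENNReal.ofReal (Real.exp (-c * (Real.exp (-α * t) * y ω + dLambda α X t ω))) ∂μ ≤
      1 + ∫⁻ ω, ENNReal.ofReal (Real.exp (-(2 * c) * y ω)) ∂μ +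
        (Φ (4 * c) + Φ (T * (4 * c * (α * Real.exp (α * T))))) := by
  set k := α * Real.exp (α * T) with hk
  have hk0 : 0 < k := by positivity
  have hXt : Measurable (X t) :=
    hXm.comp (measurable_prodMk_right (y := (⟨t, ht⟩ : Icc (0 : ℝ) T)))
  have hcont : ∀ ω, Continuous fun u : Icc (0 : ℝ) T => X u ω := fun ω =>
    continuousOn_iff_continuous_domRestrict.1 (hXc ω)
  have hdL : ∀ ω, |dLambda α X t ω| ≤ |X t ω| + k * ∫ u : Icc (0 : ℝ) T, |X u ω| ∂timeMeasure T := by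
    intro ω
    obtain ⟨C, hC⟩ := isCompact_univ.exists_bound_of_continuousOn (hcont ω).continuousOn
    have hi : Integrable (fun u : Icc (0 : ℝ) T => X u ω) (timeMeasure T) :=
      Integrable.of_bound (hcont ω).aestronglyMeasurable C (ae_of_all _ fun u => hC u (mem_univ u))
    have h := enorm_dLambda_le hα X ht ω
    have e := ofReal_integral_norm_eq_lintegral_enorm hi
    simp only [Real.norm_eq_abs] at e
    rw [← e, ← ENNReal.ofReal_mul hk0.le, Real.enorm_eq_ofReal_abs, Real.enorm_eq_ofReal_abs,
      ← ENNReal.ofReal_add (abs_nonneg _) (by positivity)] at h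
    exact (ENNReal.ofReal_le_ofReal_iff (by positivity)).1 h
  -- Splitting `e^{a+b}` by `2xy ≤ x² + y²` avoids any independence assumption. Each use doubles the
  -- exponents, hence the constants `2c` and `4c`.
  have hadd : ∀ a b : ℝ, Real.exp (a + b) ≤ Real.exp (2 * a) + Real.exp (2 * b) := by
    intro a b
    have e1 : Real.exp (2 * a) = Real.exp a ^ 2 := by rw [← Real.exp_nat_mul]; norm_num
    have e2 : Real.exp (2 * b) = Real.exp b ^ 2 := by rw [← Real.exp_nat_mul]; norm_num
    rw [Real.exp_add, e1, e2]
    nlinarith [sq_nonneg (Real.exp a - Real.exp b), Real.exp_pos a, Real.exp_pos b]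
  have hpt : ∀ ω, ENNReal.ofReal (Real.exp (-c * (Real.exp (-α * t) * y ω + dLambda α X t ω))) ≤
      1 + ENNReal.ofReal (Real.exp (-(2 * c) * y ω)) +
        (ENNReal.ofReal (Real.exp (4 * c * |X t ω|)) + ENNReal.ofReal T⁻¹ *
          ∫⁻ u : Icc (0 : ℝ) T, ENNReal.ofReal (Real.exp (T * (4 * c * k) * |X u ω|))
            ∂timeMeasure T) := by
    intro ω
    -- As `e^{-αt}` lies in `(0, 1]`, the exponential is at most `1` where `y ≥ 0` and is largest
    -- without that factor where `y ≤ 0`. Only negative values of `y` cost a moment.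
    have h1 : Real.exp (2 * (-c * (Real.exp (-α * t) * y ω))) ≤
        1 + Real.exp (-(2 * c) * y ω) := by
      have ht1 : Real.exp (-α * t) ≤ 1 := Real.exp_le_one_iff.2 (by nlinarith [ht.1])
      have ht0 := Real.exp_pos (-α * t)
      rcases le_total 0 (y ω) with h0 | h0
      · have : Real.exp (2 * (-c * (Real.exp (-α * t) * y ω))) ≤ 1 := by
          rw [Real.exp_le_one_iff]
          have : 0 ≤ c * (Real.exp (-α * t) * y ω) := by positivity
          linarith
        linarith [Real.exp_pos (-(2 * c) * y ω)]
      · have : Real.exp (2 * (-c * (Real.exp (-α * t) * y ω))) ≤ Real.exp (-(2 * c) * y ω) := by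
          rw [Real.exp_le_exp]
          have : y ω ≤ Real.exp (-α * t) * y ω := by nlinarith
          nlinarith
        linarith
    have h2 : Real.exp (2 * (-c * dLambda α X t ω)) ≤ Real.exp (4 * c * |X t ω|) +
        Real.exp (∫ u : Icc (0 : ℝ) T, 4 * c * k * |X u ω| ∂timeMeasure T) := by
      have h3 : 2 * (-c * dLambda α X t ω) ≤ 2 * c * |X t ω| +
          2 * c * k * ∫ u : Icc (0 : ℝ) T, |X u ω| ∂timeMeasure T := by
        have := hdL ω
        have h4 := neg_abs_le (dLambda α X t ω)
        nlinarith
      refine (Real.exp_le_exp.2 h3).trans ((hadd _ _).trans (le_of_eq ?_))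
      rw [integral_const_mul]
      congr 2 <;> ring
    have h5 := exp_integral_le hT (f := fun u : Icc (0 : ℝ) T => 4 * c * k * |X u ω|)
      (continuous_const.mul (hcont ω).abs)
    simp only [← mul_assoc] at h5 ⊢
    calc _ ≤ ENNReal.ofReal ((1 + Real.exp (-(2 * c) * y ω)) + (Real.exp (4 * c * |X t ω|) +
        Real.exp (∫ u : Icc (0 : ℝ) T, 4 * c * k * |X u ω| ∂timeMeasure T))) := by
          refine ENNReal.ofReal_le_ofReal ?_
          rw [mul_add]
          exact (hadd _ _).trans (add_le_add h1 h2)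
      _ = 1 + ENNReal.ofReal (Real.exp (-(2 * c) * y ω)) +
          (ENNReal.ofReal (Real.exp (4 * c * |X t ω|)) +
          ENNReal.ofReal (Real.exp (∫ u : Icc (0 : ℝ) T, 4 * c * k * |X u ω| ∂timeMeasure T))) := by
          rw [ENNReal.ofReal_add (by positivity) (by positivity),
            ENNReal.ofReal_add zero_le_one (by positivity),
            ENNReal.ofReal_add (by positivity) (by positivity), ENNReal.ofReal_one]
      _ ≤ _ := by gcongr
  have hm1 : Measurable fun ω => ENNReal.ofReal (Real.exp (-(2 * c) * y ω)) := by fun_prop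
  have hm2 : Measurable fun ω => ENNReal.ofReal (Real.exp (4 * c * |X t ω|)) := by fun_prop
  have hm3 : Measurable fun q : Ω × Icc (0 : ℝ) T =>
      ENNReal.ofReal (Real.exp (T * (4 * c * k) * |X q.2 q.1|)) := by
    have : Measurable fun q : Ω × Icc (0 : ℝ) T => |X q.2 q.1| := hXm.norm
    fun_prop
  refine (lintegral_mono hpt).trans ?_
  have hm0 : Measurable fun ω => 1 + ENNReal.ofReal (Real.exp (-(2 * c) * y ω)) :=
    measurable_const.add hm1
  rw [lintegral_add_left hm0, lintegral_add_left measurable_const,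
    lintegral_add_left hm2, lintegral_const, measure_univ, mul_one,
    lintegral_const_mul' _ _ ENNReal.ofReal_ne_top, lintegral_lintegral_swap hm3.aemeasurable]
  gcongr
  · exact hΦ t ht _
  · calc _ ≤ ENNReal.ofReal T⁻¹ * ∫⁻ _ : Icc (0 : ℝ) T, Φ (T * (4 * c * k)) ∂timeMeasure T := by
          gcongr with u
          exact hΦ u u.2 _
      _ = Φ (T * (4 * c * k)) := by
          rw [lintegral_const, timeMeasure_univ, mul_comm (Φ _), ← mul_assoc,
            ← ENNReal.ofReal_mul (by positivity), inv_mul_cancel₀ hT.ne', ENNReal.ofReal_one,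
            one_mul]

end Moments

/-! ### Norms in `D_β` -/

section DSpaceNorm

variable {Ω : Type*} [mΩ : MeasurableSpace Ω] {T : ℝ} {F : Filtration (Icc (0 : ℝ) T) mΩ}
  {μ : Measure Ω} {β : ℝ} {hβ : 1 < β}

theorem norm_toD_sub_sub_smul {X Y Z : ℝ → Ω → ℝ} (hX : MemD F μ β hβ X) (hY : MemD F μ β hβ Y)
    (hZ : MemD F μ β hβ Z) (c : ℝ) :
    ‖toD F μ β hβ X - toD F μ β hβ Y - c • toD F μ β hβ Z‖ =
      (processENorm μ β fun (t : Icc (0 : ℝ) T) ω => X t ω - Y t ω - c * Z t ω).toReal := by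
  rw [toD, toD, toD, dif_pos hX, dif_pos hY, dif_pos hZ, ← SeparationQuotient.mk_smul,
    ← SeparationQuotient.mk_sub, ← SeparationQuotient.mk_sub, SeparationQuotient.norm_mk]
  rfl

end DSpaceNorm

/-! ### Second order remainder of the exponential -/

/-- For `|x| ≤ 1` this is the usual quadratic estimate; for `|x| > 1` the factor `x² > |x|` absorbs
the linear term and `1 + e^x` the exponential. -/
theorem abs_exp_sub_one_sub_id_le_sq_mul (x : ℝ) :
    |Real.exp x - 1 - x| ≤ x ^ 2 * (1 + Real.exp x) := by
  have h0 : 0 ≤ Real.exp x - 1 - x := by linarith [Real.add_one_le_exp x]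
  have hp := Real.exp_pos x
  rcases le_or_gt |x| 1 with h | h
  · exact (Real.abs_exp_sub_one_sub_id_le h).trans (by nlinarith [sq_nonneg x])
  · have hx2 : 1 < x ^ 2 := by rw [← sq_abs]; nlinarith
    rw [abs_of_nonneg h0]
    rcases lt_abs.1 h with h1 | h1
    · nlinarith
    · have : Real.exp x ≤ 1 := Real.exp_le_one_iff.2 (by linarith)
      nlinarith

/-- After factoring out `e^{-s}`, the weight `e^{-s}(1 + e^{-(s'-s)})` is `e^{-s} + e^{-s'}`. Only
exponentials with known moments remain. -/
theorem enorm_exp_remainder_le (s s' l ε : ℝ) :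
    ‖Real.exp (-s') - Real.exp (-s) - ε * (-Real.exp (-s) * l)‖ₑ ≤
      ‖s' - s‖ₑ ^ 2 * (‖Real.exp (-s)‖ₑ + ‖Real.exp (-s')‖ₑ) +
        ‖Real.exp (-s)‖ₑ * ‖s' - s - ε * l‖ₑ := by
  have h1 : Real.exp (-s') - Real.exp (-s) - ε * (-Real.exp (-s) * l) =
      Real.exp (-s) * (Real.exp (-(s' - s)) - 1 - (-(s' - s))) -
        Real.exp (-s) * (s' - s - ε * l) := by
    have : Real.exp (-s') = Real.exp (-s) * Real.exp (-(s' - s)) := by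
      rw [← Real.exp_add]
      congr 1
      ring
    rw [this]
    ring
  rw [h1]
  refine enorm_sub_le.trans (add_le_add ?_ (enorm_mul _ _).le)
  rw [← enorm_pow, Real.enorm_of_nonneg (Real.exp_pos (-s)).le, Real.enorm_of_nonneg (Real.exp_pos (-s')).le,
    ← ENNReal.ofReal_add (Real.exp_pos _).le (Real.exp_pos _).le, Real.enorm_of_nonneg (sq_nonneg _),
    ← ENNReal.ofReal_mul (sq_nonneg _), Real.enorm_eq_ofReal_abs, abs_mul, Real.abs_exp]
  refine ENNReal.ofReal_le_ofReal ?_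
  have h2 := abs_exp_sub_one_sub_id_le_sq_mul (-(s' - s))
  have h3 : Real.exp (-s') = Real.exp (-s) * Real.exp (-(s' - s)) := by
    rw [← Real.exp_add]
    congr 1
    ring
  calc _ ≤ Real.exp (-s) * ((-(s' - s)) ^ 2 * (1 + Real.exp (-(s' - s)))) := by gcongr
    _ = _ := by rw [h3]; ring

/-- The constant in the estimate of the remainder of `e^{-σ}`. -/
def remainderConst (p : ℝ) (M K₁ K₂ : ℝ≥0∞) : ℝ≥0∞ :=
  2 ^ (p - 1) * (K₁ ^ (1 / 2 : ℝ) * (2 ^ (2 * p - 1) * (M + M)) ^ (1 / 2 : ℝ) +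
    M ^ (1 / 2 : ℝ) * K₂ ^ (1 / 2 : ℝ))

theorem remainderConst_ne_top {p : ℝ} (hp : 1 ≤ p) {M K₁ K₂ : ℝ≥0∞} (hM : M ≠ ∞) (h₁ : K₁ ≠ ∞)
    (h₂ : K₂ ≠ ∞) : remainderConst p M K₁ K₂ ≠ ∞ := by
  have hs : ∀ x : ℝ≥0∞, x ≠ ∞ → x ^ (1 / 2 : ℝ) ≠ ∞ := fun x hx =>
    ENNReal.rpow_ne_top_of_nonneg (by norm_num) hx
  exact ENNReal.mul_ne_top (ENNReal.rpow_ne_top_of_nonneg (by linarith) (by simp))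
    (ENNReal.add_ne_top.2 ⟨ENNReal.mul_ne_top (hs _ h₁) (hs _ (ENNReal.mul_ne_top
      (ENNReal.rpow_ne_top_of_nonneg (by linarith) (by simp)) (ENNReal.add_ne_top.2 ⟨hM, hM⟩))),
      ENNReal.mul_ne_top (hs _ hM) (hs _ h₂)⟩)

/-- Cauchy-Schwarz separates exponentials from increments, doubling `p`; the squared increment
doubles it again, hence `4p`. Here `a` measures the increment and `b` the linearization error. -/
theorem lintegral_exp_remainder_le {Ω : Type*} [MeasurableSpace Ω] {μ : Measure Ω} {p : ℝ}
    (hp : 1 ≤ p) {s s' l : Ω → ℝ} (hs : Measurable s) (hs' : Measurable s') (hl : Measurable l)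
    {ε : ℝ} {M K₁ K₂ a b : ℝ≥0∞}
    (hM : ∫⁻ ω, ‖Real.exp (-s ω)‖ₑ ^ (2 * p) ∂μ ≤ M)
    (hM' : ∫⁻ ω, ‖Real.exp (-s' ω)‖ₑ ^ (2 * p) ∂μ ≤ M)
    (h₁ : ∫⁻ ω, ‖s' ω - s ω‖ₑ ^ (4 * p) ∂μ ≤ K₁ * a ^ (4 * p))
    (h₂ : ∫⁻ ω, ‖s' ω - s ω - ε * l ω‖ₑ ^ (2 * p) ∂μ ≤ K₂ * b ^ (2 * p)) :
    ∫⁻ ω, ‖Real.exp (-s' ω) - Real.exp (-s ω) - ε * (-Real.exp (-s ω) * l ω)‖ₑ ^ p ∂μ ≤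
      remainderConst p M K₁ K₂ * (a ^ 2 + b) ^ p := by
  have hp0 : 0 ≤ p := by linarith
  have me : Measurable fun ω => ‖Real.exp (-s ω)‖ₑ := by fun_prop
  have me' : Measurable fun ω => ‖Real.exp (-s' ω)‖ₑ := by fun_prop
  have md : Measurable fun ω => ‖s' ω - s ω‖ₑ ^ 2 := by fun_prop
  have mr : Measurable fun ω => ‖s' ω - s ω - ε * l ω‖ₑ := by fun_prop
  have b1 : ∫⁻ ω, (‖s' ω - s ω‖ₑ ^ 2 * (‖Real.exp (-s ω)‖ₑ + ‖Real.exp (-s' ω)‖ₑ)) ^ p ∂μ ≤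
      K₁ ^ (1 / 2 : ℝ) * (2 ^ (2 * p - 1) * (M + M)) ^ (1 / 2 : ℝ) * (a ^ 2 + b) ^ p := by
    have e1 : ∫⁻ ω, (‖s' ω - s ω‖ₑ ^ 2) ^ (2 * p) ∂μ ≤ K₁ * a ^ (4 * p) := by
      refine le_trans (le_of_eq (lintegral_congr fun ω => ?_)) h₁
      rw [← ENNReal.rpow_natCast, ← ENNReal.rpow_mul]
      congr 1
      push_cast
      ring
    have e2 : ∫⁻ ω, (‖Real.exp (-s ω)‖ₑ + ‖Real.exp (-s' ω)‖ₑ) ^ (2 * p) ∂μ ≤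
        2 ^ (2 * p - 1) * (M + M) := by
      calc _ ≤ ∫⁻ ω, 2 ^ (2 * p - 1) * (‖Real.exp (-s ω)‖ₑ ^ (2 * p) +
            ‖Real.exp (-s' ω)‖ₑ ^ (2 * p)) ∂μ :=
            lintegral_mono fun ω => ENNReal.rpow_add_le_mul_rpow_add_rpow _ _ (by linarith)
        _ ≤ _ := by
            rw [lintegral_const_mul' _ _ (ENNReal.rpow_ne_top_of_nonneg (by linarith) (by simp)),
              lintegral_add_left (me.pow_const _)]
            gcongr
    have e3 : (K₁ * a ^ (4 * p)) ^ (1 / 2 : ℝ) ≤ K₁ ^ (1 / 2 : ℝ) * (a ^ 2 + b) ^ p := by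
      rw [ENNReal.mul_rpow_of_nonneg _ _ (by norm_num), ← ENNReal.rpow_mul]
      refine mul_le_mul' le_rfl ?_
      calc a ^ (4 * p * (1 / 2)) = (a ^ 2) ^ p := by
            rw [← ENNReal.rpow_natCast, ← ENNReal.rpow_mul]
            congr 1
            push_cast
            ring
        _ ≤ _ := ENNReal.rpow_le_rpow le_self_add hp0
    refine (lintegral_mul_rpow_le md.aemeasurable (me.add me').aemeasurable hp0).trans ?_
    calc _ ≤ (K₁ * a ^ (4 * p)) ^ (1 / 2 : ℝ) * (2 ^ (2 * p - 1) * (M + M)) ^ (1 / 2 : ℝ) := by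
          gcongr
          exact e2
      _ ≤ K₁ ^ (1 / 2 : ℝ) * (a ^ 2 + b) ^ p * (2 ^ (2 * p - 1) * (M + M)) ^ (1 / 2 : ℝ) := by
          gcongr
      _ = _ := by ring
  have b2 : ∫⁻ ω, (‖Real.exp (-s ω)‖ₑ * ‖s' ω - s ω - ε * l ω‖ₑ) ^ p ∂μ ≤
      M ^ (1 / 2 : ℝ) * K₂ ^ (1 / 2 : ℝ) * (a ^ 2 + b) ^ p := by
    have e3 : (K₂ * b ^ (2 * p)) ^ (1 / 2 : ℝ) ≤ K₂ ^ (1 / 2 : ℝ) * (a ^ 2 + b) ^ p := by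
      rw [ENNReal.mul_rpow_of_nonneg _ _ (by norm_num), ← ENNReal.rpow_mul,
        show 2 * p * (1 / 2) = p by ring]
      gcongr
      exact le_add_self
    refine (lintegral_mul_rpow_le me.aemeasurable mr.aemeasurable hp0).trans ?_
    rw [mul_assoc]
    gcongr
    exact (ENNReal.rpow_le_rpow h₂ (by norm_num)).trans e3
  calc _ ≤ ∫⁻ ω, 2 ^ (p - 1) *
        ((‖s' ω - s ω‖ₑ ^ 2 * (‖Real.exp (-s ω)‖ₑ + ‖Real.exp (-s' ω)‖ₑ)) ^ p +
          (‖Real.exp (-s ω)‖ₑ * ‖s' ω - s ω - ε * l ω‖ₑ) ^ p) ∂μ := by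
        refine lintegral_mono fun ω => ?_
        exact (ENNReal.rpow_le_rpow (enorm_exp_remainder_le _ _ _ _) hp0).trans
          (ENNReal.rpow_add_le_mul_rpow_add_rpow _ _ hp)
    _ ≤ 2 ^ (p - 1) * (K₁ ^ (1 / 2 : ℝ) * (2 ^ (2 * p - 1) * (M + M)) ^ (1 / 2 : ℝ) *
          (a ^ 2 + b) ^ p + M ^ (1 / 2 : ℝ) * K₂ ^ (1 / 2 : ℝ) * (a ^ 2 + b) ^ p) := by
        have m1 : Measurable fun ω =>
            (‖s' ω - s ω‖ₑ ^ 2 * (‖Real.exp (-s ω)‖ₑ + ‖Real.exp (-s' ω)‖ₑ)) ^ p :=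
          (md.mul (me.add me')).pow_const _
        rw [lintegral_const_mul' _ _ (ENNReal.rpow_ne_top_of_nonneg (by linarith) (by simp)),
          lintegral_add_left m1]
        gcongr
    _ = _ := by
        rw [remainderConst]
        ring

/-! ### Fractional Brownian motion -/

theorem stronglyMeasurable_limUnder {Ω : Type*} {m : MeasurableSpace Ω} {f : ℕ → Ω → ℝ}
    (hf : ∀ n, StronglyMeasurable[m] (f n)) :
    StronglyMeasurable[m] fun ω => limUnder atTop fun n => f n ω :=
  StronglyMeasurable.limUnder hf

section Fractional

variable {Ω : Type*} [mΩ : MeasurableSpace Ω] {μ : Measure Ω} {W : ℝ → Ω → ℝ} {H : ℝ}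
  {X : ℝ → Ω → ℝ}

theorem IsFractionalBrownian.ae_zero (hW : IsTwoSidedBrownian μ W)
    (h : IsFractionalBrownian μ W H X) : X 0 =ᵐ[μ] 0 := by
  have h1 := h.repr 0 le_rfl
  have h2 := h1.eLpNorm_le hW
  have h3 : kernel H 0 = 0 := funext fun s => kernel_zero H s
  rw [h3, eLpNorm_zero] at h2
  exact (eLpNorm_eq_zero_iff h1.2.1.aestronglyMeasurable two_ne_zero).1 (le_antisymm h2 zero_le)

/-- The integral equation sees only `X_t - X_0`, while `X_0 = 0` holds merely almost surely. The
shifted process is the one used throughout. -/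
theorem IsFractionalBrownian.repr_sub_zero (hW : IsTwoSidedBrownian μ W)
    (h : IsFractionalBrownian μ W H X) {t : ℝ} (ht : 0 ≤ t) :
    IsWienerIntegral μ W (kernel H t) (fun ω => X t ω - X 0 ω) := by
  refine (h.repr t ht).congr_ae ?_
  filter_upwards [h.ae_zero hW] with ω hω
  rw [hω]
  simp

theorem IsFractionalBrownian.isStronglyProgressive {T : ℝ} {B : ℝ≥0 → Ω → ℝ}
    (hWB : IsDrivingPair μ W B) (h : IsFractionalBrownian μ W H X) :
    IsStronglyProgressive (naturalFiltration T hWB)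
      (fun (t : Icc (0 : ℝ) T) ω => X t ω - X 0 ω) := by
  refine StronglyAdapted.isStronglyProgressive_of_continuous (fun t => ?_) fun ω => ?_
  · refine Measurable.stronglyMeasurable ?_
    refine (h.repr_sub_zero hWB.brownian_W t.2.1).measurable_naturalFiltration hWB
      ((h.measurable _ t.2.1).sub (h.measurable _ le_rfl)) t fun s hs => ?_
    exact kernel_eq_zero_of_lt H t.2.1 hs
  · have h1 : Continuous fun t : Icc (0 : ℝ) T => X t ω :=
      continuousOn_iff_continuous_domRestrict.1 ((h.continuous ω).mono Icc_subset_Ici_self)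
    exact h1.sub continuous_const

/-- The derivative process `∫ ∂_H K^H(t,s) dW_s` has a progressively measurable version. -/
theorem exists_isKernelDerivProcess {T : ℝ} (hT : 0 ≤ T) {B : ℝ≥0 → Ω → ℝ}
    (hWB : IsDrivingPair μ W B) {BH : ℝ → ℝ → Ω → ℝ}
    (hBH : ∀ H ∈ Ioo (0 : ℝ) 1, IsFractionalBrownian μ W H (BH H)) (hH : H ∈ Ioo (0 : ℝ) 1) :
    ∃ A : ℝ → Ω → ℝ, IsKernelDerivProcess (naturalFiltration T hWB) μ W H A := by
  have hW := hWB.brownian_W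
  obtain ⟨C, r, hC, hr0, hr, hKD, hev⟩ := exists_kernel_bounds hT hH
  -- The difference quotient is within `2^{-n}` of `∂_H K^H` in `L²(ℝ)`, uniformly in `t`. One
  -- sequence serves all times, so the limit process inherits progressive measurability.
  have hseq : ∀ n : ℕ, ∃ h : ℝ, h ∈ Ioo (0 : ℝ) 1 ∧ h ≠ H ∧ ∀ t ∈ Icc 0 T,
      eLpNorm (fun s => (h - H)⁻¹ * (kernel h t s - kernel H t s) - kernelDeriv H t s) 2 volume ≤
        (2⁻¹ : ℝ≥0∞) ^ n := by
    intro n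
    have h1 : ∀ᶠ h in 𝓝[≠] H, ‖r h‖ ≤ (2⁻¹ : ℝ) ^ n * ‖h - H‖ :=
      (hr.def (by positivity)).filter_mono nhdsWithin_le_nhds
    obtain ⟨h, hh1, hh2, hne⟩ := (h1.and ((hev.filter_mono nhdsWithin_le_nhds).and
      self_mem_nhdsWithin)).exists
    have hne' : h - H ≠ 0 := sub_ne_zero.2 hne
    refine ⟨h, hh2.1, hne, fun t ht => ?_⟩
    have h2 := (hh2.2 t ht).2.2
    have e : (fun s => (h - H)⁻¹ * (kernel h t s - kernel H t s) - kernelDeriv H t s) =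
        (h - H)⁻¹ • fun s => kernel h t s - kernel H t s - (h - H) * kernelDeriv H t s := by
      ext s
      simp only [Pi.smul_apply, smul_eq_mul]
      field_simp
    rw [e, eLpNorm_const_smul]
    calc ‖(h - H)⁻¹‖ₑ * _ ≤ ‖(h - H)⁻¹‖ₑ * ENNReal.ofReal (r h) := by gcongr
      _ = ENNReal.ofReal (|h - H|⁻¹ * r h) := by
          rw [Real.enorm_eq_ofReal_abs, ← ENNReal.ofReal_mul (abs_nonneg _), abs_inv]
      _ ≤ ENNReal.ofReal ((2⁻¹ : ℝ) ^ n) := by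
          refine ENNReal.ofReal_le_ofReal ?_
          rw [Real.norm_of_nonneg (hr0 h), Real.norm_eq_abs] at hh1
          rw [inv_mul_le_iff₀ (abs_pos.2 hne'), mul_comm]
          exact hh1
      _ = (2⁻¹ : ℝ≥0∞) ^ n := by
          rw [ENNReal.ofReal_pow (by positivity), ENNReal.ofReal_inv_of_pos two_pos]
          simp
  choose h hh hne hbd using hseq
  set Z : ℕ → ℝ → Ω → ℝ := fun n t ω => (h n - H)⁻¹ *
    ((BH (h n) t ω - BH (h n) 0 ω) - (BH H t ω - BH H 0 ω)) with hZ
  have hZW : ∀ n, ∀ t ∈ Icc 0 T, IsWienerIntegral μ W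
      (fun s => (h n - H)⁻¹ * (kernel (h n) t s - kernel H t s)) (Z n t) := fun n t ht =>
    (((hBH _ (hh n)).repr_sub_zero hW ht.1).sub hW ((hBH H hH).repr_sub_zero hW ht.1)).const_mul _
  -- `limUnder` keeps measurability wherever the sequence diverges; its default values are harmless
  -- because at each time divergence has probability `0`.
  refine ⟨fun t ω => limUnder atTop fun n => Z n t ω, ?_, ?_⟩
  · intro i
    refine stronglyMeasurable_limUnder fun n => ?_
    have := ((hBH _ (hh n)).isStronglyProgressive (T := T) hWB).sub
      ((hBH H hH).isStronglyProgressive hWB)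
    exact (this i).const_mul _
  · intro t ht
    -- The factor `3` instead of `2` makes the inequality strict; the bounds are summable, which
    -- gives almost sure convergence and not only convergence in `L²`.
    have hcau : ∀ N n m : ℕ, N ≤ n → N ≤ m →
        eLpNorm (Z n t - Z m t) 2 μ < 3 * (2⁻¹ : ℝ≥0∞) ^ N := by
      intro N n m hn hm
      have h1 := ((hZW n t ht).sub hW (hZW m t ht)).eLpNorm_le hW
      have m1 := (hZW n t ht).1.sub (hKD t ht).1
      have m2 := (hZW m t ht).1.sub (hKD t ht).1
      have h2 := eLpNorm_sub_le m1.aestronglyMeasurable m2.aestronglyMeasurable one_le_two (p := 2)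
      rw [sub_sub_sub_cancel_right] at h2
      have hp : ∀ {k : ℕ}, N ≤ k → (2⁻¹ : ℝ≥0∞) ^ k ≤ (2⁻¹ : ℝ≥0∞) ^ N := fun hk =>
        pow_le_pow_right_of_le_one' (by simp) hk
      have h3 : (2⁻¹ : ℝ≥0∞) ^ N ≠ ∞ := by finiteness
      have h4 : (2⁻¹ : ℝ≥0∞) ^ N ≠ 0 := by simp
      calc _ ≤ (2⁻¹ : ℝ≥0∞) ^ N + (2⁻¹ : ℝ≥0∞) ^ N :=
            (h1.trans h2).trans (add_le_add ((hbd n t ht).trans (hp hn)) ((hbd m t ht).trans (hp hm)))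
        _ = 2 * (2⁻¹ : ℝ≥0∞) ^ N := (two_mul _).symm
        _ < 3 * (2⁻¹ : ℝ≥0∞) ^ N := by
            rw [ENNReal.mul_lt_mul_iff_left h4 h3]
            norm_num
    have hsum : ∑' N : ℕ, 3 * (2⁻¹ : ℝ≥0∞) ^ N ≠ ∞ := by
      rw [ENNReal.tsum_mul_left, ENNReal.tsum_geometric]
      simp [ENNReal.mul_eq_top]
    obtain ⟨Y, hY, hYlim⟩ := Lp.cauchy_complete_eLpNorm one_le_two
      (fun n => (hZW n t ht).2.1) hsum hcau
    have hae := Lp.ae_tendsto_of_cauchy_eLpNorm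
      (fun n => (hZW n t ht).2.1.aestronglyMeasurable) one_le_two hsum hcau
    obtain ⟨ns, hns, hns'⟩ := (tendstoInMeasure_of_tendsto_eLpNorm two_ne_zero
      (fun n => (hZW n t ht).2.1.aestronglyMeasurable) hY.aestronglyMeasurable
      hYlim).exists_seq_tendsto_ae
    have hYW : IsWienerIntegral μ W (kernelDeriv H t) Y := by
      refine IsWienerIntegral.of_tendsto hW (fun n => hZW n t ht) (hKD t ht).1 hY ?_ hYlim
      refine tendsto_of_tendsto_of_tendsto_of_le_of_le tendsto_const_nhds
        (ENNReal.tendsto_pow_atTop_nhds_zero_of_lt_one ?_) (fun _ => zero_le) fun n => hbd n t ht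
      simp
    refine hYW.congr_ae ?_
    filter_upwards [hae, hns'] with ω h1 h2
    obtain ⟨l, hl⟩ := h1
    rw [hl.limUnder_eq]
    exact tendsto_nhds_unique h2 (hl.comp hns.tendsto_atTop)

end Fractional

/-! ### The fractional Ornstein-Uhlenbeck process -/

section OrnsteinUhlenbeck

variable {Ω : Type*} [mΩ : MeasurableSpace Ω] {μ : Measure Ω} {T α : ℝ} {W : ℝ → Ω → ℝ}
  {B : ℝ≥0 → Ω → ℝ} {σ₀ : Ω → ℝ} {H : ℝ} {X Y : ℝ → Ω → ℝ}

/-- The bound depends on `H` only through `C`, so it is uniform over all Hurst parameters whose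
kernels share that bound. -/
theorem lintegral_exp_neg_le [IsProbabilityMeasure μ] (hT : 0 < T) (hα : 0 < α)
    (hWB : IsDrivingPair μ W B) (hσ₀ : Measurable σ₀) (hX : IsFractionalBrownian μ W H X)
    (hY : IsOrnsteinUhlenbeck T α σ₀ X Y) {C : ℝ}
    (hC : ∀ t ∈ Icc 0 T, eLpNorm (kernel H t) 2 volume ≤ ENNReal.ofReal C) {q : ℝ} (hq : 0 < q)
    {t : ℝ} (ht : t ∈ Icc 0 T) :
    ∫⁻ ω, ‖Real.exp (-Y t ω)‖ₑ ^ q ∂μ ≤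
      1 + ∫⁻ ω, ENNReal.ofReal (Real.exp (-(2 * q) * σ₀ ω)) ∂μ +
        (2 * ENNReal.ofReal (Real.exp ((4 * q) ^ 2 * C ^ 2 / 2)) +
          2 * ENNReal.ofReal (Real.exp ((T * (4 * q * (α * Real.exp (α * T)))) ^ 2 * C ^ 2 / 2))) := by
  refine le_trans (le_of_eq (lintegral_congr fun ω => ?_)) (lintegral_exp_dLambda_le hT hα hq hσ₀
    (X := fun t ω => X t ω - X 0 ω)
    (measurable_uncurry_of_progressive (hX.isStronglyProgressive (T := T) hWB))
    (fun ω => ((hX.continuous ω).mono Icc_subset_Ici_self).sub continuousOn_const)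
    (fun s hs c => (hX.repr_sub_zero hWB.brownian_W hs.1).lintegral_exp_abs_le hWB.brownian_W
      (hC s hs) c) ht)
  rw [← hY.eq_dLambda hT.le (hX.continuous ω) ht, Real.enorm_of_nonneg (Real.exp_pos _).le,
    ENNReal.ofReal_rpow_of_pos (Real.exp_pos _), ← Real.exp_mul]
  congr 2
  ring

theorem IsOrnsteinUhlenbeck.isStronglyProgressive (hT : 0 < T) (hWB : IsDrivingPair μ W B)
    (hσ₀ : Measurable[naturalFiltration T hWB ⟨0, le_rfl, hT.le⟩] σ₀)
    (hX : IsFractionalBrownian μ W H X) (hY : IsOrnsteinUhlenbeck T α σ₀ X Y) :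
    IsStronglyProgressive (naturalFiltration T hWB) (fun t : Icc (0 : ℝ) T => Y t) := by
  have h1 := isStronglyProgressive_time_mul hT.le
    (φ := fun t => Real.exp (-α * t)) (by fun_prop) hσ₀
  have h2 := isStronglyProgressive_dLambda (α := α)
    (A := fun t ω => X t ω - X 0 ω) (hX.isStronglyProgressive (T := T) hWB)
  have h3 : (fun t : Icc (0 : ℝ) T => Y t) = fun (t : Icc (0 : ℝ) T) ω =>
      Real.exp (-α * t) * σ₀ ω + dLambda α (fun t ω => X t ω - X 0 ω) t ω := by
    ext t ω
    exact hY.eq_dLambda hT.le (hX.continuous ω) t.2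
  rw [h3]
  exact h1.add h2

theorem lintegral_dLambda_wiener_le [SFinite μ] (hα : 0 < α) (hW : IsTwoSidedBrownian μ W)
    {f : ℝ → ℝ → ℝ} {A : ℝ → Ω → ℝ} {r : ℝ} (hr : 0 < r)
    (hA : ∀ t ∈ Icc 0 T, IsWienerIntegral μ W (f t) (A t))
    (hAm : Measurable fun q : Ω × Icc (0 : ℝ) T => A q.2 q.1)
    (hf : ∀ t ∈ Icc 0 T, eLpNorm (f t) 2 volume ≤ ENNReal.ofReal r) {p : ℝ} (hp : 1 ≤ p)
    {t : ℝ} (ht : t ∈ Icc 0 T) :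
    ∫⁻ ω, ‖dLambda α A t ω‖ₑ ^ p ∂μ ≤ dLambdaConst T α p *
      (ENNReal.ofReal (2 * p ^ p * Real.exp (1 / 2)) * ENNReal.ofReal r ^ p) :=
  lintegral_dLambda_rpow_le hα hp hAm (fun s hs =>
    (hA s hs).lintegral_rpow_le hW hr (hf s hs) (by linarith)) ht

/-- The derivative process is not assumed to have regular paths. A finite first moment, uniform in
time, gives the path integrability that `dLambda_linear` needs. -/
theorem ae_intervalIntegrable_wiener [SFinite μ] (hT : 0 ≤ T) (hW : IsTwoSidedBrownian μ W)
    {f : ℝ → ℝ → ℝ} {A : ℝ → Ω → ℝ} {r : ℝ} (hr : 0 < r)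
    (hA : ∀ t ∈ Icc 0 T, IsWienerIntegral μ W (f t) (A t))
    (hAm : Measurable fun q : Ω × Icc (0 : ℝ) T => A q.2 q.1)
    (hf : ∀ t ∈ Icc 0 T, eLpNorm (f t) 2 volume ≤ ENNReal.ofReal r) :
    ∀ᵐ ω ∂μ, IntervalIntegrable (fun u => A u ω) volume 0 T := by
  have h1 := lintegral_rpow_lintegral_le (p := 1) le_rfl hAm (fun s hs =>
    (hA s hs).lintegral_rpow_le hW hr (hf s hs) one_pos)
  simp only [ENNReal.rpow_one] at h1
  have h2 := ae_lt_top hAm.enorm.lintegral_prod_right' (h1.trans_lt (by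
    simp only [sub_self, ENNReal.rpow_zero]
    finiteness)).ne
  filter_upwards [h2] with ω hω
  rw [intervalIntegrable_iff_timeMeasure hT]
  exact ⟨(hAm.comp (measurable_prodMk_left (x := ω))).aestronglyMeasurable, hω⟩

theorem memD_of_lintegral_le [SFinite μ] {F : Filtration (Icc (0 : ℝ) T) mΩ} {β : ℝ} (hβ : 1 < β)
    {Z : ℝ → Ω → ℝ} (hZ : IsStronglyProgressive F (fun t : Icc (0 : ℝ) T => Z t)) {m : ℝ≥0∞}
    (hm : m ≠ ∞) (h : ∀ t ∈ Icc 0 T, ∫⁻ ω, ‖Z t ω‖ₑ ^ (2 * β) ∂μ ≤ m) : MemD F μ β hβ Z := by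
  have h0 : 0 < β := by linarith
  refine ⟨hZ, (processENorm_le hβ (measurable_uncurry_of_progressive hZ)
    (fun t => h t t.2)).trans_lt ?_⟩
  refine ENNReal.rpow_lt_top_of_nonneg (by positivity) (ENNReal.mul_ne_top ?_ hm)
  exact ENNReal.rpow_ne_top_of_nonneg h0.le ENNReal.ofReal_ne_top

end OrnsteinUhlenbeck

end HurstSensitivity

end

/-! ### The main theorem. -/

open HurstSensitivity in
theorem mainTheorem6 {Ω : Type*} [mΩ : MeasurableSpace Ω] (μ : Measure Ω) [IsProbabilityMeasure μ]
    (T α β : ℝ) (hT : 0 < T) (hα : 0 < α) (hβ : 1 < β)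
    (W : ℝ → Ω → ℝ) (B : ℝ≥0 → Ω → ℝ) (hWB : IsDrivingPair μ W B)
    (σ₀ : Ω → ℝ)
    (hσ₀_meas : Measurable[naturalFiltration T hWB ⟨0, le_rfl, hT.le⟩] σ₀)
    (hσ₀_exp : ∀ c : ℝ, 0 < c → Integrable (fun ω => Real.exp (-c * σ₀ ω)) μ)
    (BH : ℝ → ℝ → Ω → ℝ)
    (hBH : ∀ H ∈ Ioo (0 : ℝ) 1, IsFractionalBrownian μ W H (BH H))
    (σ : ℝ → ℝ → Ω → ℝ)
    (hσ : ∀ H ∈ Ioo (0 : ℝ) 1, IsOrnsteinUhlenbeck T α σ₀ (BH H) (σ H)) :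
    ∀ H ∈ Ioo (0 : ℝ) 1,
      (∃ A : ℝ → Ω → ℝ, IsKernelDerivProcess (naturalFiltration T hWB) μ W H A) ∧
      MemD (naturalFiltration T hWB) μ β hβ (fun t ω => Real.exp (-σ H t ω)) ∧
      ∀ A : ℝ → Ω → ℝ, IsKernelDerivProcess (naturalFiltration T hWB) μ W H A →
        MemD (naturalFiltration T hWB) μ β hβ
          (fun t ω => -Real.exp (-σ H t ω) * dLambda α A t ω) ∧
        HasFDerivAt
          (fun h : ℝ => toD (naturalFiltration T hWB) μ β hβ (fun t ω => Real.exp (-σ h t ω)))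
          (ContinuousLinearMap.toSpanSingleton ℝ
            (toD (naturalFiltration T hWB) μ β hβ
              (fun t ω => -Real.exp (-σ H t ω) * dLambda α A t ω)))
          H := by
  intro H hH
  have hW := hWB.brownian_W
  have hσ₀ : Measurable σ₀ := hσ₀_meas.mono ((naturalFiltration T hWB).le _) le_rfl
  obtain ⟨C, r, hC, hr0, hr, hKD, hev⟩ := exists_kernel_bounds hT.le hH
  have hp0 : 0 < 2 * β := by linarith
  have hp1 : 1 ≤ 2 * β := by linarith
  have hdL : ∀ q : ℝ, 1 ≤ q → dLambdaConst T α q ≠ ∞ := fun q hq => dLambdaConst_ne_top T α hq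
  have hprog : ∀ h ∈ Ioo (0 : ℝ) 1,
      IsStronglyProgressive (naturalFiltration T hWB) (fun t : Icc (0 : ℝ) T => σ h t) := fun h hh =>
    (hσ h hh).isStronglyProgressive hT hWB hσ₀_meas (hBH h hh)
  have hprogE : ∀ h ∈ Ioo (0 : ℝ) 1, IsStronglyProgressive (naturalFiltration T hWB)
      (fun (t : Icc (0 : ℝ) T) ω => Real.exp (-σ h t ω)) := fun h hh =>
    isStronglyProgressive_comp (hprog h hh) (φ := fun x => Real.exp (-x)) (by fun_prop)
  have hat : ∀ {Z : ℝ → Ω → ℝ}, IsStronglyProgressive (naturalFiltration T hWB)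
      (fun t : Icc (0 : ℝ) T => Z t) → ∀ t ∈ Icc 0 T, Measurable (Z t) := fun hZ t ht =>
    (measurable_uncurry_of_progressive hZ).comp
      (measurable_prodMk_right (y := (⟨t, ht⟩ : Icc (0 : ℝ) T)))
  -- `M` depends on `q` but not on `h`: a single moment bound holds for all `h` near `H`.
  obtain ⟨M, hMtop, hM⟩ : ∃ M : ℝ → ℝ≥0∞, (∀ q, 0 < q → M q ≠ ∞) ∧ ∀ h ∈ Ioo (0 : ℝ) 1,
      (∀ t ∈ Icc 0 T, eLpNorm (kernel h t) 2 volume ≤ ENNReal.ofReal C) → ∀ q, 0 < q →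
      ∀ t ∈ Icc 0 T, ∫⁻ ω, ‖Real.exp (-σ h t ω)‖ₑ ^ q ∂μ ≤ M q :=
    ⟨_, fun q hq => by
      have h1 : ∫⁻ ω, ENNReal.ofReal (Real.exp (-(2 * q) * σ₀ ω)) ∂μ ≠ ∞ :=
        (hσ₀_exp (2 * q) (by positivity)).lintegral_lt_top.ne
      finiteness, fun h hh hCh q hq t ht =>
      lintegral_exp_neg_le hT hα hWB hσ₀ (hBH h hh) (hσ h hh) hCh hq ht⟩
  have hMH := hM H hH fun t ht => (hev.self_of_nhds.2 t ht).1
  have hmemE : ∀ h ∈ Ioo (0 : ℝ) 1,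
      (∀ t ∈ Icc 0 T, eLpNorm (kernel h t) 2 volume ≤ ENNReal.ofReal C) →
      MemD (naturalFiltration T hWB) μ β hβ (fun t ω => Real.exp (-σ h t ω)) := fun h hh hCh =>
    memD_of_lintegral_le hβ (hprogE h hh) (hMtop _ hp0) (hM h hh hCh _ hp0)
  refine ⟨exists_isKernelDerivProcess hT.le hWB hBH hH,
    hmemE H hH fun t ht => (hev.self_of_nhds.2 t ht).1, fun A hA => ?_⟩
  have hAm := measurable_uncurry_of_progressive hA.progressive
  have hLprog := isStronglyProgressive_dLambda (α := α) hA.progressive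
  have hLmom : ∀ q : ℝ, 1 ≤ q → ∀ t ∈ Icc 0 T, ∫⁻ ω, ‖dLambda α A t ω‖ₑ ^ q ∂μ ≤ _ :=
    fun q hq t ht => lintegral_dLambda_wiener_le hα hW hC hA.repr hAm (fun t ht => (hKD t ht).2) hq ht
  have hmemD : MemD (naturalFiltration T hWB) μ β hβ
      (fun t ω => -Real.exp (-σ H t ω) * dLambda α A t ω) := by
    refine memD_of_lintegral_le hβ (m := M (2 * (2 * β)) ^ (1 / 2 : ℝ) *
      (dLambdaConst T α (2 * (2 * β)) * (ENNReal.ofReal (2 * (2 * (2 * β)) ^ (2 * (2 * β)) *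
        Real.exp (1 / 2)) * ENNReal.ofReal C ^ (2 * (2 * β)))) ^ (1 / 2 : ℝ)) ?_ ?_ fun t ht => ?_
    · exact (isStronglyProgressive_comp (hprogE H hH) (φ := fun x => -x) (by fun_prop)).mul hLprog
    · refine ENNReal.mul_ne_top (ENNReal.rpow_ne_top_of_nonneg (by norm_num) (hMtop _ (by linarith)))
        (ENNReal.rpow_ne_top_of_nonneg (by norm_num) (ENNReal.mul_ne_top (hdL _ (by linarith))
        (ENNReal.mul_ne_top ENNReal.ofReal_ne_top
          (ENNReal.rpow_ne_top_of_nonneg (by linarith) ENNReal.ofReal_ne_top))))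
    · simp_rw [enorm_mul, enorm_neg]
      refine (lintegral_mul_rpow_le (hat (Z := fun t ω => Real.exp (-σ H t ω)) (hprogE H hH) t ht).enorm.aemeasurable
        (hat hLprog t ht).enorm.aemeasurable hp0.le).trans ?_
      gcongr
      · exact hMH _ (by linarith) t ht
      · exact hLmom _ (by linarith) t ht
  refine ⟨hmemD, ?_⟩
  set p := 2 * β with hp
  set K₁ := dLambdaConst T α (4 * p) * (ENNReal.ofReal (2 * (4 * p) ^ (4 * p) * Real.exp (1 / 2)) *
    ENNReal.ofReal C ^ (4 * p)) with hK₁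
  set K₂ := dLambdaConst T α (2 * p) *
    ENNReal.ofReal (2 * (2 * p) ^ (2 * p) * Real.exp (1 / 2)) with hK₂
  have hK₁top : K₁ ≠ ∞ := ENNReal.mul_ne_top (hdL _ (by linarith)) (ENNReal.mul_ne_top
    ENNReal.ofReal_ne_top (ENNReal.rpow_ne_top_of_nonneg (by linarith) ENNReal.ofReal_ne_top))
  have hK₂top : K₂ ≠ ∞ := ENNReal.mul_ne_top (hdL _ (by linarith)) ENNReal.ofReal_ne_top
  set K := remainderConst p (M (2 * p)) K₁ K₂ with hK
  have hKtop : K ≠ ∞ := remainderConst_ne_top hp1 (hMtop _ (by linarith)) hK₁top hK₂top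
  set K' := ((ENNReal.ofReal T ^ β * K) ^ (1 / p)).toReal with hK'
  have hbound : ∀ᶠ h in 𝓝 H,
      ‖toD (naturalFiltration T hWB) μ β hβ (fun t ω => Real.exp (-σ h t ω)) -
        toD (naturalFiltration T hWB) μ β hβ (fun t ω => Real.exp (-σ H t ω)) -
        (h - H) • toD (naturalFiltration T hWB) μ β hβ
          (fun t ω => -Real.exp (-σ H t ω) * dLambda α A t ω)‖ ≤
        K' * (2 * |h - H| ^ 2 + r h) := by
    -- Only `h ∈ (0,1)` close to `H` matter, so the default value of `toD` outside `D_β` never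
    -- enters.
    filter_upwards [hev] with h hh
    obtain ⟨hh1, hh2⟩ := hh
    -- The moment bounds require a strictly positive scale, here `C |h - H|`.
    rcases eq_or_ne h H with rfl | hne
    · simp only [sub_self, zero_smul, norm_zero]
      have := hr0 h
      positivity
    have hε : 0 < |h - H| := abs_pos.2 (sub_ne_zero.2 hne)
    rw [norm_toD_sub_sub_smul (hmemE h hh1 fun t ht => (hh2 t ht).1)
      (hmemE H hH fun t ht => (hev.self_of_nhds.2 t ht).1) hmemD]
    set Xh : ℝ → Ω → ℝ := fun t ω => BH h t ω - BH h 0 ω with hXh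
    set XH : ℝ → Ω → ℝ := fun t ω => BH H t ω - BH H 0 ω with hXH
    have hXhp := (hBH h hh1).isStronglyProgressive (T := T) hWB
    have hXHp := (hBH H hH).isStronglyProgressive (T := T) hWB
    have hint : ∀ h' ∈ Ioo (0 : ℝ) 1, ∀ ω, IntervalIntegrable
        (fun u => BH h' u ω - BH h' 0 ω) volume 0 T := fun h' hh' ω => by
      refine ContinuousOn.intervalIntegrable ?_
      rw [uIcc_of_le hT.le]
      exact (((hBH h' hh').continuous ω).mono Icc_subset_Ici_self).sub continuousOn_const
    have hdiff : ∀ t ∈ Icc 0 T, ∀ ω, σ h t ω - σ H t ω = dLambda α Xh t ω - dLambda α XH t ω := by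
      intro t ht ω
      rw [(hσ h hh1).eq_dLambda hT.le ((hBH h hh1).continuous ω) ht,
        (hσ H hH).eq_dLambda hT.le ((hBH H hH).continuous ω) ht]
      ring
    have hb₁ : ∀ t ∈ Icc 0 T, ∫⁻ ω, ‖σ h t ω - σ H t ω‖ₑ ^ (4 * p) ∂μ ≤
        K₁ * ENNReal.ofReal |h - H| ^ (4 * p) := by
      intro t ht
      have h1 := lintegral_dLambda_wiener_le (T := T) (p := 4 * p)
        (A := fun t ω => Xh t ω - XH t ω) hα hW (mul_pos hC hε) (fun t ht =>
        ((hBH h hh1).repr_sub_zero hW ht.1).sub hW ((hBH H hH).repr_sub_zero hW ht.1))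
        (measurable_uncurry_of_progressive (hXhp.sub hXHp)) (fun t ht => (hh2 t ht).2.1)
        (by linarith) ht
      rw [ENNReal.ofReal_mul hC.le, ENNReal.mul_rpow_of_nonneg _ _ (by linarith)] at h1
      refine le_trans (le_of_eq (lintegral_congr fun ω => ?_))
        (h1.trans (le_of_eq (by rw [hK₁]; ring)))
      -- With `ε = 0` the third process is irrelevant; any integrable one will do.
      have h2 := dLambda_linear (α := α) (ε := 0) (X := Xh) (Y := XH) (A := XH) (ω := ω) hT.le (hint h hh1 ω) (hint H hH ω) (hint H hH ω) ht
      simp only [zero_mul, sub_zero] at h2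
      rw [hdiff t ht, ← h2]
    have hb₂ : ∀ t ∈ Icc 0 T, ∫⁻ ω, ‖σ h t ω - σ H t ω - (h - H) * dLambda α A t ω‖ₑ ^ (2 * p) ∂μ ≤
        K₂ * ENNReal.ofReal (r h + |h - H| ^ 2) ^ (2 * p) := by
      intro t ht
      -- The scale is `r h + |h - H|²` because `r h` may vanish, while the moment bound needs a
      -- positive scale. The added term is still `o(h - H)`.
      have h1 := lintegral_dLambda_wiener_le (T := T) (p := 2 * p)
        (A := fun t ω => Xh t ω - XH t ω - (h - H) * A t ω) (r := r h + |h - H| ^ 2) hα hW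
        (by have := hr0 h; positivity) (fun t ht =>
        (((hBH h hh1).repr_sub_zero hW ht.1).sub hW ((hBH H hH).repr_sub_zero hW ht.1)).sub hW
          ((hA.repr t ht).const_mul (h - H)))
        (measurable_uncurry_of_progressive ((hXhp.sub hXHp).sub
          (isStronglyProgressive_comp hA.progressive (φ := fun x => (h - H) * x) (by fun_prop))))
        (fun t ht => ((hh2 t ht).2.2).trans (ENNReal.ofReal_le_ofReal (by
          linarith [sq_nonneg |h - H|]))) (by linarith) ht
      refine le_trans (le_of_eq (lintegral_congr_ae ?_))
        (h1.trans (le_of_eq (by rw [hK₂]; ring)))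
      filter_upwards [ae_intervalIntegrable_wiener hT.le hW hC hA.repr hAm
        (fun t ht => (hKD t ht).2)] with ω hω
      rw [hdiff t ht, dLambda_linear (X := Xh) (Y := XH) (A := A) (ω := ω) hT.le (hint h hh1 ω) (hint H hH ω) hω ht]
    have hrem : ∀ t : Icc (0 : ℝ) T, ∫⁻ ω, ‖Real.exp (-σ h t ω) - Real.exp (-σ H t ω) -
        (h - H) * (-Real.exp (-σ H t ω) * dLambda α A t ω)‖ₑ ^ p ∂μ ≤
        K * (ENNReal.ofReal |h - H| ^ 2 + ENNReal.ofReal (r h + |h - H| ^ 2)) ^ p := fun t =>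
      lintegral_exp_remainder_le hp1 (hat (hprog H hH) t t.2) (hat (hprog h hh1) t t.2)
        (hat hLprog t t.2) (hMH _ (by linarith) t t.2)
        (hM h hh1 (fun t ht => (hh2 t ht).1) _ (by linarith) t t.2) (hb₁ t t.2) (hb₂ t t.2)
    have hprogR : IsStronglyProgressive (naturalFiltration T hWB)
        (fun (t : Icc (0 : ℝ) T) ω => Real.exp (-σ h t ω) - Real.exp (-σ H t ω) -
          (h - H) * (-Real.exp (-σ H t ω) * dLambda α A t ω)) :=
      ((hprogE h hh1).sub (hprogE H hH)).sub
        (isStronglyProgressive_comp hmemD.1 (φ := fun x => (h - H) * x) (by fun_prop))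
    have hfin := processENorm_le hβ (measurable_uncurry_of_progressive hprogR) hrem
    have hsum : ENNReal.ofReal |h - H| ^ 2 + ENNReal.ofReal (r h + |h - H| ^ 2) =
        ENNReal.ofReal (2 * |h - H| ^ 2 + r h) := by
      have := hr0 h
      rw [← ENNReal.ofReal_pow hε.le, ← ENNReal.ofReal_add (by positivity) (by positivity)]
      congr 1
      ring
    rw [hsum, ← mul_assoc, ENNReal.mul_rpow_of_nonneg _ _ (by positivity), ← hp,
      ← ENNReal.rpow_mul, mul_one_div_cancel hp0.ne', ENNReal.rpow_one] at hfin
    have h0 := hr0 h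
    have hKfin : (ENNReal.ofReal T ^ β * K) ^ (1 / p) ≠ ∞ :=
      ENNReal.rpow_ne_top_of_nonneg (by positivity) (ENNReal.mul_ne_top
        (ENNReal.rpow_ne_top_of_nonneg (by linarith) ENNReal.ofReal_ne_top) hKtop)
    refine (ENNReal.toReal_mono (ENNReal.mul_ne_top hKfin ENNReal.ofReal_ne_top) hfin).trans ?_
    rw [ENNReal.toReal_mul, ENNReal.toReal_ofReal (by positivity)]
  have hsq : (fun h : ℝ => |h - H| ^ 2) =o[𝓝 H] fun h => h - H := by
    have h1 : (fun h : ℝ => (h - H) ^ 2) =o[𝓝 H] fun h => h - H :=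
      (Asymptotics.isLittleO_pow_id (𝕜 := ℝ) one_lt_two).comp_tendsto
        (show Tendsto (fun h : ℝ => h - H) (𝓝 H) (𝓝 0) from by
          simpa using (continuous_sub_right H).tendsto H)
    simpa only [sq_abs] using h1
  have hlittle : (fun h : ℝ => K' * (2 * |h - H| ^ 2 + r h)) =o[𝓝 H] fun h => h - H :=
    ((hsq.const_mul_left 2).add hr).const_mul_left K'
  rw [hasFDerivAt_iff_isLittleO]
  refine Asymptotics.IsBigO.trans_isLittleO (Asymptotics.IsBigO.of_bound 1 ?_) hlittle
  filter_upwards [hbound] with h hh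
  rw [one_mul]
  exact hh.trans (le_abs_self _)
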